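/- Let $n\ge 1$, let $M(n)$ be the algebra of complex $n\times n$ matrices and put $d(k)=k(k+1)/2$. For $x\in M(n)$ and $1\le m\le n$ let $x_m$ be the upper left $m\times m$ corner of $x$; regard $M(m)$ as the subalgebra of $M(n)$ of matrices supported in that corner, with identity element $\mathrm{Id}_m$. Define $\Phi_n:M(n)\to\mathbb C^{d(n)}$ by $\Phi_n(x)=(f_{k,m}(x))_{1\le k\le m\le n}$, where $$\det(\lambda-x_m)=\lambda^m+\sum_{k=1}^m(-1)^{m-k+1}f_{k,m}(x)\,\lambda^{k-1}.$$ For $c\in\mathbb C^{d(n)}$ put $M_c(n)=\Phi_n^{-1}(c)$, let $M_c^{(sym)}(n)$ be the set of symmetric matrices in $M_c(n)$, and let $E_c(m)$ be the multiset of roots of $\lambda^m+\sum_{k=1}^m(-1)^{m-k+1}c_{k,m}\lambda^{k-1}$. Let $\Omega(n)$ be the set of $c\in\mathbb C^{d(n)}$ such that, for every $m\le n$, the elements of $E_c(m)$ are distinct and, for every $m\le n-1$, $E_c(m)\cap E_c(m+1)=\emptyset$. Give $M(n)$ the Poisson structure in which the matrix entries satisfy $[\alpha_{ij},\alpha_{st}]=\delta_{js}\alpha_{it}-\delta_{it}\alpha_{sj}$,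 and for $1\le k\le m\le n-1$ let $\xi_{(k,m)}$ be the Hamiltonian vector field of $x\mapsto\frac1{m+1-k}\operatorname{tr}(x_m)^{m+1-k}$, so that $(\xi_{(k,m)})_x=[(x_m)^{m-k},x]$, with $(x_m)^0=\mathrm{Id}_m$. Let $A=A(1)\times\cdots\times A(n-1)\cong\mathbb C^{d(n-1)}$ be the simply connected complex Lie group whose Lie algebra is spanned by the commuting fields $\xi_{(k,m)}$, acting on $M(n)$ by integrating them: for $a(m)=\exp\sum_k z_k\xi_{(k,m)}\in A(m)$ one has $a(m)\cdot x=g\,x\,g^{-1}$ with $g=\exp\bigl(-\sum_k z_k (x_m)^{m-k}\bigr)\in Gl(n)$, and $(a(1),\dots,a(n-1))\cdot x=a(1)\cdot(\cdots(a(n-1)\cdot x))$. This action preserves each $M_c(n)$. Put $D_c=\{a\in A\mid a\cdot x=x\ \ \forall x\in M_c(n)\}$ and $A_c=A/D_c$, with the induced action on $M_c(n)$, and let $F_c$ be the group of elements of order $\le 2$ in $A_c$. **Theorem.** Let $c\in\Omega(n)$. Then $A_c$ is a complex torus of dimension $d(n-1)$, that is, there are a $\mathbb C$-linear automorphism $L$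 of $A\cong\mathbb C^{d(n-1)}$ and a group isomorphism $\varphi:A_c\to(\mathbb C^\times)^{d(n-1)}$ such that $\varphi(aD_c)_i=e^{L(a)_i}$ for all $a\in A$ and all $i$; and $A_c$ acts simply transitively on $M_c(n)$. The set $M_c^{(sym)}(n)$ is finite of cardinality $2^{d(n-1)}$, and it is a single orbit of $F_c$. -/

import Mathlib

open Polynomial

namespace GelfandZeitlin

/-- `M(n)`, the algebra of complex `n × n` matrices. -/
abbrev M (n : ℕ) : Type := Matrix (Fin n) (Fin n) ℂ

/-- `d(k) = k (k + 1) / 2`. -/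
def d (k : ℕ) : ℕ := k * (k + 1) / 2

/-- The `d(n)` pairs `(m, k)` with `1 ≤ k ≤ m ≤ n`. All indices are shifted by one: the element
`⟨m, k⟩` of this type stands for the pair `(m + 1, k + 1)`. -/
abbrev Idx (n : ℕ) : Type := (m : Fin n) × Fin ((m : ℕ) + 1)

theorem card_idx (n : ℕ) : Fintype.card (Idx n) = d n := by
  simp only [Fintype.card_sigma, Fintype.card_fin, d]
  rw [Fin.sum_univ_eq_sum_range (fun i => i + 1) n]
  have := Finset.sum_range_id_mul_two (n + 1)
  rw [Finset.sum_range_succ'] at this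
  simp only [add_zero, add_tsub_cancel_right] at this
  rw [mul_comm n, ← this, Nat.mul_div_cancel _ two_pos]

/-! ### The fibers `M_c(n)` of the map `Φ_n` and the set `Ω(n)` -/

/-- The upper left `m × m` corner of `x`, as an `m × m` matrix. -/
def corner {n m : ℕ} (h : m ≤ n) (x : M n) : M m :=
  x.submatrix (Fin.castLE h) (Fin.castLE h)

/-- The coefficient `f_{k,m}(x)` of the characteristic polynomial of the corner `x_m`:
`det (λ - x_m) = λ ^ m + ∑_{k=1}^m (-1)^(m-k+1) f_{k,m}(x) λ^(k-1)`. It is the elementary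
symmetric polynomial of degree `m - k + 1` in the eigenvalues of `x_m`. -/
noncomputable def charCoeff {n : ℕ} (i : Idx n) (x : M n) : ℂ :=
  (-1) ^ ((i.1 : ℕ) + 1 - (i.2 : ℕ)) * (corner (Nat.succ_le_of_lt i.1.2) x).charpoly.coeff i.2

/-- The map `Φ_n : M(n) → ℂ^{d(n)}`. -/
noncomputable def Phi {n : ℕ} (x : M n) : Idx n → ℂ := fun i => charCoeff i x

/-- The fiber `M_c(n) = Φ_n⁻¹(c)`. -/
def fiber (n : ℕ) (c : Idx n → ℂ) : Set (M n) := {x | Phi x = c}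

/-- The set of symmetric matrices in `M_c(n)`. -/
def symFiber (n : ℕ) (c : Idx n → ℂ) : Set (M n) := {x | x ∈ fiber n c ∧ x.transpose = x}

/-- The monic polynomial `λ ^ m + ∑_{k=1}^m (-1)^(m-k+1) c_{k,m} λ^(k-1)` of degree `m` (where `m`
stands for `m + 1`). -/
noncomputable def levelPoly {n : ℕ} (c : Idx n → ℂ) (m : Fin n) : ℂ[X] :=
  X ^ ((m : ℕ) + 1) +
    ∑ k : Fin ((m : ℕ) + 1), C ((-1) ^ ((m : ℕ) + 1 - (k : ℕ)) * c ⟨m, k⟩) * X ^ (k : ℕ)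

/-- `E_c(m)`: the roots, with multiplicity, of the `m`-th polynomial attached to `c`. -/
noncomputable def eigs {n : ℕ} (c : Idx n → ℂ) (m : Fin n) : Multiset ℂ := (levelPoly c m).roots

/-- `Ω(n)`: the `c` that satisfy the eigenvalue disjointness condition. -/
def Omega (n : ℕ) : Set (Idx n → ℂ) :=
  {c | (∀ m, (eigs c m).Nodup) ∧
    ∀ m m' : Fin n, (m' : ℕ) = (m : ℕ) + 1 → Disjoint (eigs c m) (eigs c m')}

/-- For `c = Φ_n(x)` the `m`-th polynomial attached to `c` is the characteristic polynomial
of `x_m`. -/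
theorem levelPoly_Phi {n : ℕ} (x : M n) (m : Fin n) :
    levelPoly (Phi x) m = (corner (Nat.succ_le_of_lt m.2) x).charpoly := by
  set q := (corner (Nat.succ_le_of_lt m.2) x).charpoly with hq
  have hd : q.natDegree = (m : ℕ) + 1 := by
    rw [hq, Matrix.charpoly_natDegree_eq_dim, Fintype.card_fin]
  have hm : q.Monic := Matrix.charpoly_monic _
  rw [hm.as_sum, hd, levelPoly,
    ← Fin.sum_univ_eq_sum_range (fun i => C (q.coeff i) * X ^ i)]
  congr 1
  refine Finset.sum_congr rfl fun k _ => ?_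
  rw [Phi, charCoeff, ← mul_assoc, ← mul_pow]
  simp [hq]

/-! ### Hamiltonian vector fields on `M(n)` -/

/-- The Hamiltonian vector field `ξ_f` of a function `f` on `M(n)`, for the Poisson structure with
`[α_ij, α_st] = δ_js α_it - δ_it α_sj`, where `α_ij` are the matrix entries (see `hamVec_entry`):
if `G` is the gradient of `f` at `x` for the trace form, then `(ξ_f)_x = G x - x G`. -/
noncomputable def hamVec {n : ℕ} (f : M n → ℂ) (x : M n) : M n :=
  let G : M n := Matrix.of fun i j => lineDeriv ℂ f x (Matrix.single j i 1)
  G * x - x * G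

/-- `Id_m`, as an element of `M(m) ⊆ M(n)` (upper left hand corner). -/
def idm (n m : ℕ) : M n := Matrix.diagonal fun i => if (i : ℕ) < m then 1 else 0

/-- The cutoff `x_m`, as an element of `M(m) ⊆ M(n)`. -/
def cutoff {n : ℕ} (m : ℕ) (x : M n) : M n :=
  Matrix.of fun i j => if (i : ℕ) < m ∧ (j : ℕ) < m then x i j else 0

/-- The invariants `f_{(k,m)}(x) = tr (x_m ^ (m + 1 - k)) / (m + 1 - k)`. -/
noncomputable def trPow (n m k : ℕ) (x : M n) : ℂ :=
  (1 / ((m + 1 - k : ℕ) : ℂ)) * (cutoff m x ^ (m + 1 - k)).trace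

/-! ### The group `A` and its action -/

/-- The simply connected group `A = A(1) × ⋯ × A(n-1) ≅ ℂ^{d(n-1)}`, in the coordinates given by
the basis `ξ_{(k,m)}`, `1 ≤ k ≤ m ≤ n - 1`, of its Lie algebra. It is written additively. -/
abbrev A (n : ℕ) : Type := Idx (n - 1) → ℂ

/-- The value on `∑_k z_k ξ_{(k,m)}` of the Lie algebra homomorphism `ξ_{(k,m)} ↦ -(x_m)^(m-k)`,
where `(x_m)^0 = Id_m`. -/
noncomputable def rhoLie {n : ℕ} (m : ℕ) (z : Fin m → ℂ) (x : M n) : M n :=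
  -∑ k : Fin m, z k • (idm n m * cutoff m x ^ (m - ((k : ℕ) + 1)))

/-- The homomorphism `ρ_{x,m} : A(m) → GL(m) ⊆ GL(n)` with that differential. -/
noncomputable def rho {n : ℕ} (m : ℕ) (z : Fin m → ℂ) (x : M n) : M n :=
  NormedSpace.exp (rhoLie m z x)

/-- The action of `A(m)`: `z · x = ρ_{x,m}(z) x ρ_{x,m}(z)⁻¹`. -/
noncomputable def flow {n : ℕ} (m : ℕ) (z : Fin m → ℂ) (x : M n) : M n :=
  rho m z x * x * (rho m z x)⁻¹

/-- The action of `A`: `a · x = a(1) · (a(2) · ( ⋯ (a(n-1) · x)))`. By `hasDerivAt_act` below,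
this is the flow that integrates the Hamiltonian vector fields `ξ_{(k,m)}`. -/
noncomputable def act {n : ℕ} (a : A n) (x : M n) : M n :=
  (List.finRange (n - 1)).foldr (fun (m : Fin (n - 1)) y => flow ((m : ℕ) + 1) (fun k => a ⟨m, k⟩) y) x


section facts
variable {n : ℕ}

theorem hamVec_entry (i j s t : Fin n) (x : M n) :
    hamVec (fun y => y i j) x s t =
      (if j = s then x i t else 0) - (if i = t then x s j else 0) := by
  have h : ∀ v : M n, lineDeriv ℂ (fun y : M n => y i j) x v = v i j := by
    intro v
    have : (fun t : ℂ => (x + t • v) i j) = fun t => x i j + t * v i j := by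
      ext t; simp
    rw [lineDeriv, this]
    simp
  have hG : (Matrix.of fun a b => lineDeriv ℂ (fun y : M n => y i j) x (Matrix.single b a 1)) =
      Matrix.single j i (1 : ℂ) := by
    ext a b
    simp only [Matrix.of_apply, h, Matrix.single_apply]
    grind
  simp only [hamVec, hG, Matrix.sub_apply]
  congr 1
  · by_cases hjs : j = s
    · subst hjs; simp
    · simp [hjs, Matrix.single_mul_apply_of_ne, Ne.symm hjs]
  · by_cases hit : i = t
    · subst hit; simp
    · simp [hit, Matrix.mul_single_apply_of_ne, Ne.symm hit]

theorem cutoff_eq (m : ℕ) (x : M n) : cutoff m x = idm n m * x * idm n m := by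
  ext i j
  simp only [cutoff, idm, Matrix.of_apply, Matrix.diagonal_mul, Matrix.mul_diagonal]
  grind

theorem idm_mul {j m : ℕ} (h : j ≤ m) : idm n j * idm n m = idm n j := by
  simp only [idm, Matrix.diagonal_mul_diagonal]
  congr 1; ext i; grind

theorem mul_idm {j m : ℕ} (h : j ≤ m) : idm n m * idm n j = idm n j := by
  simp only [idm, Matrix.diagonal_mul_diagonal]
  congr 1; ext i; grind

theorem commute_idm_cutoff {j m : ℕ} (h : j ≤ m) (x : M n) :
    Commute (idm n m) (cutoff j x) := by
  rw [cutoff_eq]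
  unfold Commute SemiconjBy
  rw [← mul_assoc, ← mul_assoc, mul_idm h, mul_assoc _ (idm n j) (idm n m), idm_mul h]

theorem cutoff_cutoff {j m : ℕ} (h : j ≤ m) (x : M n) : cutoff j (cutoff m x) = cutoff j x := by
  ext a b
  simp only [cutoff, Matrix.of_apply]
  grind

theorem commute_rhoLie {m : ℕ} (z : Fin m → ℂ) (x y : M n) (h1 : Commute y (idm n m))
    (h2 : Commute y (cutoff m x)) : Commute y (rhoLie m z x) :=
  (Commute.sum_right _ _ _ fun _ _ => ((h1.mul_right (h2.pow_right _)).smul_right _)).neg_right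

theorem commute_idm_rhoLie {j m : ℕ} (h : j ≤ m) (z : Fin j → ℂ) (x : M n) :
    Commute (idm n m) (rhoLie j z x) := by
  refine commute_rhoLie z x _ ?_ (commute_idm_cutoff h x)
  unfold Commute SemiconjBy
  rw [mul_idm h, idm_mul h]

theorem commute_cutoff_rhoLie {m : ℕ} (z : Fin m → ℂ) (x : M n) :
    Commute (cutoff m x) (rhoLie m z x) :=
  commute_rhoLie z x _ (commute_idm_cutoff le_rfl x).symm (Commute.refl _)

theorem commute_rhoLie_rhoLie {m : ℕ} (z w : Fin m → ℂ) (x : M n) :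
    Commute (rhoLie m z x) (rhoLie m w x) :=
  commute_rhoLie w x _ (commute_idm_rhoLie le_rfl z x).symm (commute_cutoff_rhoLie z x).symm

theorem rhoLie_add {m : ℕ} (z w : Fin m → ℂ) (x : M n) :
    rhoLie m (z + w) x = rhoLie m z x + rhoLie m w x := by
  simp only [rhoLie, Pi.add_apply, add_smul, Finset.sum_add_distrib, neg_add]

theorem rhoLie_zero (m : ℕ) (x : M n) : rhoLie m 0 x = 0 := by simp [rhoLie]

theorem rhoLie_congr {m : ℕ} (z : Fin m → ℂ) {x y : M n} (h : cutoff m x = cutoff m y) :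
    rhoLie m z x = rhoLie m z y := by simp only [rhoLie, h]

theorem commute_exp {x y : M n} (h : Commute x y) : Commute x (NormedSpace.exp y) := by
  open scoped Matrix.Norms.Operator in exact h.exp_right

theorem isUnit_rho {m : ℕ} (z : Fin m → ℂ) (x : M n) : IsUnit (rho m z x).det :=
  (Matrix.isUnit_iff_isUnit_det _).mp (Matrix.isUnit_exp _)

theorem rho_mul_inv {m : ℕ} (z : Fin m → ℂ) (x : M n) : rho m z x * (rho m z x)⁻¹ = 1 :=
  Matrix.mul_nonsing_inv _ (isUnit_rho z x)

theorem inv_mul_rho {m : ℕ} (z : Fin m → ℂ) (x : M n) : (rho m z x)⁻¹ * rho m z x = 1 :=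
  Matrix.nonsing_inv_mul _ (isUnit_rho z x)

theorem rho_inv {m : ℕ} (z : Fin m → ℂ) (x : M n) :
    (rho m z x)⁻¹ = NormedSpace.exp (-rhoLie m z x) := (Matrix.exp_neg _).symm

theorem commute_inv {m : ℕ} {y : M n} (z : Fin m → ℂ) (x : M n) (h : Commute y (rhoLie m z x)) :
    Commute y (rho m z x)⁻¹ := by
  rw [rho_inv]; exact commute_exp h.neg_right

/-- Conjugation by a matrix in the centralizer of `Id_m` commutes with the cutoff. -/
theorem cutoff_conj {m : ℕ} {g h : M n} (x : M n) (hg : Commute (idm n m) g)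
    (hh : Commute (idm n m) h) : cutoff m (g * x * h) = g * cutoff m x * h := by
  rw [cutoff_eq, cutoff_eq]
  calc idm n m * (g * x * h) * idm n m = (idm n m * g) * x * (h * idm n m) := by
        simp only [mul_assoc]
    _ = (g * idm n m) * x * (idm n m * h) := by rw [hg.eq, hh.eq]
    _ = _ := by simp only [mul_assoc]

theorem cutoff_flow {j m : ℕ} (h : j ≤ m) (z : Fin m → ℂ) (x : M n) :
    cutoff j (flow m z x) = cutoff j x := by
  rw [← cutoff_cutoff h, flow, cutoff_conj (g := rho m z x) x
    (commute_exp (commute_idm_rhoLie le_rfl z x))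
    (commute_inv z x (commute_idm_rhoLie le_rfl z x)),
    ← (show Commute (cutoff m x) (rho m z x) from commute_exp (commute_cutoff_rhoLie z x)).eq,
    mul_assoc, rho_mul_inv, mul_one, cutoff_cutoff h]

theorem flow_add {m : ℕ} (z w : Fin m → ℂ) (x : M n) :
    flow m (z + w) x = flow m z (flow m w x) := by
  have h1 : rho m z (flow m w x) = rho m z x := by
    rw [rho, rho, rhoLie_congr z (cutoff_flow le_rfl w x)]
  have h2 : rho m (z + w) x = rho m z x * rho m w x := by
    rw [rho, rhoLie_add, Matrix.exp_add_of_commute _ _ (commute_rhoLie_rhoLie z w x)]; rfl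
  rw [flow, flow, h1, h2, Matrix.mul_inv_rev, flow]
  simp only [mul_assoc]

theorem flow_zero (m : ℕ) (x : M n) : flow m 0 x = x := by
  simp [flow, rho, rhoLie_zero]

theorem rhoLie_conj {m : ℕ} (z : Fin m → ℂ) {g h : M n} (x : M n) (hgh : h * g = 1)
    (hg : Commute (idm n m) g) (hh : Commute (idm n m) h) :
    rhoLie m z (g * x * h) = g * rhoLie m z x * h := by
  have hgh' : g * h = 1 := mul_eq_one_comm.mp hgh
  have hp : ∀ p : ℕ, (g * cutoff m x * h) ^ p = g * cutoff m x ^ p * h := by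
    intro p
    induction p with
    | zero => simp [hgh']
    | succ p ih =>
      rw [pow_succ, ih, pow_succ]
      calc g * cutoff m x ^ p * h * (g * cutoff m x * h)
          = g * cutoff m x ^ p * (h * g) * (cutoff m x * h) := by simp only [mul_assoc]
        _ = _ := by rw [hgh]; simp only [mul_assoc, mul_one]
  simp only [rhoLie, cutoff_conj x hg hh, hp, mul_neg, neg_mul, Finset.mul_sum, Finset.sum_mul,
    mul_smul_comm, smul_mul_assoc]
  congr 1
  refine Finset.sum_congr rfl fun k _ => ?_
  rw [← mul_assoc, ← mul_assoc, hg.eq, mul_assoc g (idm n m)]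

theorem flow_comm_of_le {j m : ℕ} (h : j ≤ m) (z : Fin j → ℂ) (w : Fin m → ℂ) (x : M n) :
    flow j z (flow m w x) = flow m w (flow j z x) := by
  have h1 : rho j z (flow m w x) = rho j z x := by
    rw [rho, rho, rhoLie_congr z (cutoff_flow h w x)]
  have hc := commute_idm_rhoLie (n := n) h z x
  have h2 : rho m w (flow j z x) = rho j z x * rho m w x * (rho j z x)⁻¹ := by
    rw [rho, flow, rhoLie_conj (g := rho j z x) w x (inv_mul_rho z x) (commute_exp hc) (commute_inv z x hc),
      Matrix.exp_conj (rho j z x) _ (Matrix.isUnit_exp _)]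
    rfl
  have h3 : (rho m w (flow j z x))⁻¹ = rho j z x * (rho m w x)⁻¹ * (rho j z x)⁻¹ := by
    rw [h2, Matrix.mul_inv_rev, Matrix.mul_inv_rev, Matrix.nonsing_inv_nonsing_inv _
      (isUnit_rho z x), mul_assoc]
  rw [flow, h1, flow, flow, h2, Matrix.mul_inv_rev, Matrix.mul_inv_rev,
    Matrix.nonsing_inv_nonsing_inv _ (isUnit_rho z x), flow]
  have e := inv_mul_rho z x
  set g := rho j z x
  set k := rho m w x
  calc g * (k * x * k⁻¹) * g⁻¹ = g * k * 1 * x * 1 * k⁻¹ * g⁻¹ := by simp only [mul_assoc, mul_one]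
    _ = g * k * (g⁻¹ * g) * x * (g⁻¹ * g) * k⁻¹ * g⁻¹ := by rw [e]
    _ = _ := by simp only [mul_assoc]

theorem flow_comm {j m : ℕ} (z : Fin j → ℂ) (w : Fin m → ℂ) (x : M n) :
    flow j z (flow m w x) = flow m w (flow j z x) := by
  rcases le_total j m with h | h
  · exact flow_comm_of_le h z w x
  · exact (flow_comm_of_le h w z x).symm

theorem act_zero (x : M n) : act (0 : A n) x = x := by
  unfold act
  induction List.finRange (n - 1) with
  | nil => rfl
  | cons m l ih => rw [List.foldr_cons, ih]; exact flow_zero _ x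

theorem act_add (a b : A n) (x : M n) : act (a + b) x = act a (act b x) := by
  unfold act
  generalize List.finRange (n - 1) = l
  have key : ∀ (m : ℕ) (z : Fin m → ℂ) (l : List (Fin (n - 1))) (y : M n),
      flow m z (l.foldr (fun (m : Fin (n - 1)) y => flow ((m : ℕ) + 1) (fun k => a ⟨m, k⟩) y) y) =
        l.foldr (fun (m : Fin (n - 1)) y => flow ((m : ℕ) + 1) (fun k => a ⟨m, k⟩) y) (flow m z y) := by
    intro m z l y
    induction l with
    | nil => rfl
    | cons p l ih => rw [List.foldr_cons, List.foldr_cons, flow_comm, ih]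
  induction l with
  | nil => rfl
  | cons m l ih =>
    rw [List.foldr_cons, List.foldr_cons, List.foldr_cons, ih, ← key, ← flow_add]
    rfl

theorem corner_cutoff {m : ℕ} (h : m ≤ n) (x : M n) : corner h (cutoff m x) = corner h x := by
  ext i j
  simp [corner, cutoff]

theorem corner_mul {m : ℕ} (h : m ≤ n) (x y : M n) (hx : Commute (idm n m) x) :
    corner h (x * y) = corner h x * corner h y := by
  ext i j
  simp only [corner, Matrix.submatrix_apply, Matrix.mul_apply]
  have hx0 : ∀ l : Fin n, m ≤ (l : ℕ) → x (Fin.castLE h i) l = 0 := by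
    intro l hl
    have := congrFun (congrFun hx.eq (Fin.castLE h i)) l
    simpa [idm, Matrix.diagonal_mul, Matrix.mul_diagonal, hl.not_gt] using this
  symm
  refine Finset.sum_of_injOn (Fin.castLE h) (Fin.castLE_injective h).injOn (by simp) ?_ (by simp)
  intro l _ hl
  rw [hx0 l, zero_mul]
  by_contra hlt
  exact hl ⟨⟨l, by omega⟩, by simp, by ext; simp⟩

theorem Phi_flow {m : ℕ} (z : Fin m → ℂ) (x : M n) : Phi (flow m z x) = Phi x := by
  ext i
  simp only [Phi, charCoeff]
  congr 2
  set j := (i.1 : ℕ) + 1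
  have hj : j ≤ n := i.1.2
  rcases le_total j m with h | h
  · rw [← corner_cutoff hj, cutoff_flow h, corner_cutoff]
  · have hc := commute_idm_rhoLie (n := n) h z x
    have c1 : Commute (idm n j) (rho m z x) := commute_exp hc
    have c2 : Commute (idm n j) (rho m z x)⁻¹ := commute_inv z x hc
    have e : corner hj (rho m z x)⁻¹ * corner hj (rho m z x) = 1 := by
      rw [← corner_mul hj _ _ c2, inv_mul_rho]
      ext a b
      simp [corner, Matrix.one_apply]
    have c3 : corner hj (x * (rho m z x)⁻¹) = corner hj x * corner hj (rho m z x)⁻¹ := by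
      have := corner_mul hj ((rho m z x)⁻¹ : M n).transpose x.transpose (by
        have := congrArg Matrix.transpose c2.eq
        simp only [Matrix.transpose_mul] at this
        have hE : (idm n j).transpose = idm n j := Matrix.diagonal_transpose _
        rw [hE] at this
        exact this.symm)
      rw [← Matrix.transpose_mul] at this
      exact Matrix.transpose_injective ((this).trans (Matrix.transpose_mul _ _).symm)
    rw [flow, mul_assoc, corner_mul hj _ _ c1, c3, Matrix.charpoly_mul_comm, mul_assoc, e, mul_one]

theorem Phi_act (a : A n) (x : M n) : Phi (act a x) = Phi x := by
  unfold act
  induction List.finRange (n - 1) with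
  | nil => rfl
  | cons m l ih => rw [List.foldr_cons, Phi_flow, ih]

/-! ### The action of `A` integrates the vector fields `ξ_{(k,m)}` -/

theorem lineDeriv_trPow {m k : ℕ} (hk : k ≤ m) (x v : M n) :
    lineDeriv ℂ (trPow n m k) x v = ((idm n m * cutoff m x ^ (m - k)) * v).trace := by
  have hp : m + 1 - k = (m - k) + 1 := by omega
  set p := m - k
  have hE : Commute (idm n m) (cutoff m x) := commute_idm_cutoff le_rfl x
  have hEE : idm n m * idm n m = idm n m := idm_mul le_rfl
  have hYE : cutoff m x * idm n m = cutoff m x := by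
    rw [cutoff_eq, mul_assoc, hEE]
  have h1 : HasDerivAt (fun t : ℂ => cutoff m (x + t • v)) (cutoff m v) 0 := by
    have : (fun t : ℂ => cutoff m (x + t • v)) = fun t => cutoff m x + t • cutoff m v := by
      ext t i j
      simp only [cutoff, Matrix.of_apply, Matrix.add_apply, Matrix.smul_apply, smul_eq_mul]
      split_ifs <;> simp
    rw [this]
    open scoped Matrix.Norms.Operator in
    exact (((hasDerivAt_id (0 : ℂ)).smul_const (cutoff m v)).const_add (cutoff m x)).congr_deriv
      (one_smul ℂ _)
  have h2 : HasDerivAt (fun t : ℂ => (cutoff m (x + t • v) ^ (p + 1)).trace)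
      ((p + 1 : ℕ) * ((idm n m * cutoff m x ^ p) * v).trace) 0 := by
    have h3 := open scoped Matrix.Norms.Operator in h1.fun_pow' (p + 1)
    have h4 := open scoped Matrix.Norms.Operator in
      ((Matrix.traceLinearMap (Fin n) ℂ ℂ).toContinuousLinearMap.hasFDerivAt).comp_hasDerivAt
        (0 : ℂ) h3
    refine h4.congr_deriv ?_
    change (∑ i ∈ Finset.range (p + 1), cutoff m (x + (0 : ℂ) • v) ^ ((p + 1).pred - i) *
      cutoff m v * cutoff m (x + (0 : ℂ) • v) ^ i).trace = _
    simp only [zero_smul, add_zero, Matrix.trace_sum]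
    rw [Finset.sum_congr rfl (g := fun _ => ((idm n m * cutoff m x ^ p) * v).trace)]
    · simp
    · intro i hi
      have hi' : p - i + i = p := by have := Finset.mem_range.mp hi; omega
      simp only [Nat.pred_eq_sub_one, Nat.add_sub_cancel]
      rw [Matrix.trace_mul_comm, ← mul_assoc, ← pow_add, add_comm, hi', cutoff_eq m v,
        ← mul_assoc, Matrix.trace_mul_comm, ← mul_assoc, ← mul_assoc, mul_assoc _ _ (idm n m),
        ← (hE.pow_right p).eq, ← mul_assoc, hEE]
  have h5 : HasLineDerivAt ℂ (trPow n m k) (((idm n m * cutoff m x ^ p) * v).trace) x v := by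
    have h6 := h2.const_mul (1 / ((p + 1 : ℕ) : ℂ))
    have h7 : ((p + 1 : ℕ) : ℂ) ≠ 0 := by exact_mod_cast Nat.succ_ne_zero p
    rw [← mul_assoc, one_div, inv_mul_cancel₀ h7, one_mul] at h6
    simpa only [HasLineDerivAt, trPow, hp, one_div] using h6
  exact h5.lineDeriv

/-- `(ξ_{(k,m)})_x = [(x_m)^(m-k), x]`. -/
theorem hamVec_trPow {m k : ℕ} (hk : k ≤ m) (x : M n) :
    hamVec (trPow n m k) x =
      idm n m * cutoff m x ^ (m - k) * x - x * (idm n m * cutoff m x ^ (m - k)) := by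
  have : (Matrix.of fun i j => lineDeriv ℂ (trPow n m k) x (Matrix.single j i 1)) =
      idm n m * cutoff m x ^ (m - k) := by
    ext i j
    rw [Matrix.of_apply, lineDeriv_trPow hk, Matrix.trace_mul_single]
    simp
  simp only [hamVec, this]

theorem act_single (m : Fin (n - 1)) (k : Fin ((m : ℕ) + 1)) (t : ℂ) (x : M n) :
    act (Pi.single (⟨m, k⟩ : Idx (n - 1)) t) x = flow ((m : ℕ) + 1) (Pi.single k t) x := by
  have hne : ∀ p : Fin (n - 1), p ≠ m →
      (fun j => (Pi.single (⟨m, k⟩ : Idx (n - 1)) t : A n) ⟨p, j⟩) = 0 := by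
    intro p hp
    ext j
    exact Pi.single_eq_of_ne (fun h => hp (congrArg Sigma.fst h)) _
  have heq : (fun j => (Pi.single (⟨m, k⟩ : Idx (n - 1)) t : A n) ⟨m, j⟩) = Pi.single k t := by
    ext j
    simp only [Pi.single_apply, Sigma.mk.injEq, heq_eq_eq, true_and]
  have key : ∀ l : List (Fin (n - 1)), l.Nodup →
      l.foldr (fun (p : Fin (n - 1)) y => flow ((p : ℕ) + 1)
        (fun j => (Pi.single (⟨m, k⟩ : Idx (n - 1)) t : A n) ⟨p, j⟩) y) x =
      if m ∈ l then flow ((m : ℕ) + 1) (Pi.single k t) x else x := by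
    intro l hl
    induction l with
    | nil => simp
    | cons p l ih =>
      obtain ⟨hpl, hl'⟩ := List.nodup_cons.mp hl
      rw [List.foldr_cons, ih hl']
      by_cases hp : p = m
      · subst hp
        rw [if_neg hpl, if_pos List.mem_cons_self, heq]
      · rw [hne p hp, flow_zero]
        simp [List.mem_cons, Ne.symm hp]
  rw [act, key _ (List.nodup_finRange _), if_pos (List.mem_finRange m)]

/-- The one-parameter group of `ξ_{(k,m)}` in `A` acts on `M(n)` by the flow of `-ξ_{(k,m)}`, that
is, on functions, by `(exp (t ξ) f)(x) = f (exp (-t ξ) · x)`, the flow of `ξ_{(k,m)}`. -/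
theorem hasDerivAt_act (m : Fin (n - 1)) (k : Fin ((m : ℕ) + 1)) (x : M n) (t : ℂ) :
    HasDerivAt (fun s : ℂ => act (Pi.single (⟨m, k⟩ : Idx (n - 1)) s) x)
      (-hamVec (trPow n ((m : ℕ) + 1) ((k : ℕ) + 1)) (act (Pi.single (⟨m, k⟩ : Idx (n - 1)) t) x))
      t := by
  have hm : ∀ s : ℂ, cutoff ((m : ℕ) + 1) (act (Pi.single (⟨m, k⟩ : Idx (n - 1)) s) x) =
      cutoff ((m : ℕ) + 1) x := fun s => by rw [act_single, cutoff_flow le_rfl]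
  rw [hamVec_trPow (by omega), hm]
  simp only [act_single]
  set W := idm n ((m : ℕ) + 1) * cutoff ((m : ℕ) + 1) x ^ ((m : ℕ) + 1 - ((k : ℕ) + 1)) with hW
  have hr : ∀ s : ℂ, rhoLie ((m : ℕ) + 1) (Pi.single k s) x = s • (-W) := by
    intro s
    rw [rhoLie, Finset.sum_eq_single k]
    · rw [Pi.single_eq_same, smul_neg]
    · intro j _ hj
      rw [Pi.single_eq_of_ne hj, zero_smul]
    · simp
  have hf : ∀ s : ℂ, flow ((m : ℕ) + 1) (Pi.single k s) x =
      NormedSpace.exp (s • (-W)) * x * NormedSpace.exp (s • W) := by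
    intro s
    rw [flow, rho_inv, rho, hr, smul_neg, neg_neg]
  simp only [hf]
  have h1 : HasDerivAt (fun s : ℂ => NormedSpace.exp (s • (-W)) * x * NormedSpace.exp (s • W))
      (-W * NormedSpace.exp (t • -W) * x * NormedSpace.exp (t • W) +
        NormedSpace.exp (t • -W) * x * (NormedSpace.exp (t • W) * W)) t :=
    open scoped Matrix.Norms.Operator in ((hasDerivAt_exp_smul_const' (𝕂 := ℂ) (-W) t).mul_const x).mul
      (hasDerivAt_exp_smul_const (𝕂 := ℂ) W t)
  have h2 : ∀ E₁ E₂ : M n, -W * E₁ * x * E₂ + E₁ * x * (E₂ * W) =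
      -(W * (E₁ * x * E₂) - E₁ * x * E₂ * W) := fun _ _ => by noncomm_ring
  rw [h2] at h1
  exact h1

end facts

noncomputable instance (n : ℕ) : AddAction (A n) (M n) where
  vadd a x := act a x
  zero_vadd := act_zero
  add_vadd := act_add

/-- The action of `A` stabilizes each fiber `M_c(n)`. -/
noncomputable instance (n : ℕ) (c : Idx n → ℂ) : AddAction (A n) (fiber n c) where
  vadd a x := ⟨act a x.1, (Phi_act a x.1).trans x.2⟩
  zero_vadd x := Subtype.ext (act_zero x.1)
  add_vadd a b x := Subtype.ext (act_add a b x.1)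

/-- `D_c = {a ∈ A | a · x = x for all x ∈ M_c(n)}`. -/
def D (n : ℕ) (c : Idx n → ℂ) : AddSubgroup (A n) where
  carrier := {a | ∀ x : fiber n c, (a +ᵥ x : fiber n c) = x}
  zero_mem' x := zero_vadd (A n) x
  add_mem' {a b} ha hb x := by
    have h : ((a + b) +ᵥ x : fiber n c) = a +ᵥ (b +ᵥ x) := add_vadd a b x
    rw [h, hb x, ha x]
  neg_mem' {a} ha x := by
    have h : (-a +ᵥ (a +ᵥ x) : fiber n c) = x := neg_vadd_vadd a x
    rwa [ha x] at h

/-- `A_c = A / D_c`. -/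
abbrev Ac (n : ℕ) (c : Idx n → ℂ) : Type := A n ⧸ D n c

/-- The action of `A_c` on `M_c(n)` that is induced by the action of `A`. -/
noncomputable instance (n : ℕ) (c : Idx n → ℂ) : AddAction (Ac n c) (fiber n c) where
  vadd q x := Quotient.liftOn' q (fun a => a +ᵥ x) fun a b h => by
    have h' : -a + b ∈ D n c := QuotientAddGroup.leftRel_apply.mp h
    have := h' x
    rwa [add_vadd, neg_vadd_eq_iff, eq_comm] at this
  zero_vadd x := zero_vadd (A n) x
  add_vadd p q x := by
    induction p using QuotientAddGroup.induction_on
    induction q using QuotientAddGroup.induction_on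
    exact add_vadd (G := A n) _ _ x

theorem mk_vadd {n : ℕ} {c : Idx n → ℂ} (a : A n) (x : fiber n c) :
    (((a : Ac n c) +ᵥ x : fiber n c) : M n) = act a x := rfl

/-- `F_c`: the subgroup of elements of order at most `2` in `A_c`. -/
def F (n : ℕ) (c : Idx n → ℂ) : AddSubgroup (Ac n c) where
  carrier := {a | a + a = 0}
  zero_mem' := add_zero 0
  add_mem' {a b} ha hb := by
    change a + b + (a + b) = 0
    rw [add_add_add_comm, show a + a = 0 from ha, show b + b = 0 from hb, add_zero]
  neg_mem' {a} ha := by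
    change -a + -a = 0
    rw [← neg_add, show a + a = 0 from ha, neg_zero]

end GelfandZeitlin

open GelfandZeitlin

/-!
Fix a point `x` of the fiber and a size `m < n`. The corner `x_m` has simple spectrum
`μ_1, …, μ_m`, so `x_m = S diag(μ) S⁻¹`, and after conjugation by `S` (extended by the identity) the
corner of size `m + 1` becomes a bordered diagonal matrix. By `charpoly_bordered`, its corner entry
is determined by the spectra, and so are the products `u_i v_i` of its last column `u` with its last
row `v`: `u_i v_i` is, up to a nonzero factor, the value at `μ_i` of the characteristic polynomial
of `x_{m+1}`, hence nonzero on `Ω(n)`. In this basis the flow of level `m` with parameter `z` is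
conjugation by `diag(e^{ℓ_i(z)}, 1)`, with `ℓ_i(z) = -∑_k z_k μ_i^(m-k)` (`logEig`); it
multiplies `u_i` by `e^{ℓ_i(z)}` and divides `v_i` by it. The Vandermonde matrix is invertible, so
`A(m)` acts transitively on the extensions of `x_m` with the given spectrum, and the
stabilizer of every extension is `{z | ∀ i, e^{ℓ_i(z)} = 1}`, which depends on `c` only
(`exists_cutoff_flow_eq`, `exp_logEig_eq_one`).

Induction on the size gives transitivity of `A` on the fiber, and shows that `D_c` is the stabilizer
of every point and the kernel of `a ↦ exp (ℓ(a))`, where `ℓ` is a linear automorphism of `A`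
(`IsSpectrum.exists_act_eq`, `IsSpectrum.mem_D_iff`). The fiber is nonempty because the products
`u_i v_i` and the corner entry can be prescribed freely (`exists_bordered`).

For the symmetric matrices, transposition preserves the fiber and reverses the action:
`(a · x)ᵀ = (-a) · xᵀ` (`transpose_act`). If `xᵀ = a · x`, then `(a/2) · x` is symmetric, so there is
a symmetric point `x`; and then `a · x` is symmetric if and only if `2a` lies in `D_c`. Thus the
symmetric points form an orbit of the two-torsion of the torus, on which it acts freely.
-/

namespace GelfandZeitlin

open Matrix

/-! ### Bordered diagonal matrices -/

/-- Schur complement of the diagonal block. The diagonal entries `μ` need not be distinct. -/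
theorem charpoly_bordered {m : ℕ} (B : Matrix (Fin (m + 1)) (Fin (m + 1)) ℂ) (μ : Fin m → ℂ)
    (h : ∀ i j : Fin m, B i.castSucc j.castSucc = diagonal μ i j) :
    B.charpoly = (X - C (B (Fin.last m) (Fin.last m))) * ∏ j, (X - C (μ j)) -
      ∑ i, C (B i.castSucc (Fin.last m) * B (Fin.last m) i.castSucc) *
        ∏ j ∈ Finset.univ.erase i, (X - C (μ j)) := by
  -- Both sides agree at every `t` off the diagonal entries, where the Schur complement applies.
  refine eq_of_infinite_eval_eq _ _ ((Set.finite_range μ).infinite_compl.mono fun t ht => ?_)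
  have hne : ∀ j, t - μ j ≠ 0 := fun j hj => ht ⟨j, (sub_eq_zero.mp hj).symm⟩
  set A : Matrix (Fin m) (Fin m) ℂ := diagonal fun j => t - μ j with hA
  let _ : Invertible A := ⟨diagonal fun j => (t - μ j)⁻¹, by
      rw [hA, diagonal_mul_diagonal]; simp [hne], by
      rw [hA, diagonal_mul_diagonal]; simp [hne]⟩
  have hinv : ⅟A = diagonal fun j => (t - μ j)⁻¹ := rfl
  have hblock : (scalar (Fin (m + 1)) t - B).submatrix (finSumFinEquiv (m := m) (n := 1))
      (finSumFinEquiv (m := m) (n := 1)) =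
      fromBlocks A (of fun i _ => -B i.castSucc (Fin.last m))
        (of fun _ j => -B (Fin.last m) j.castSucc)
        (of fun _ _ => t - B (Fin.last m) (Fin.last m)) := by
    have hl : Fin.natAdd m (0 : Fin 1) = Fin.last m := rfl
    have hc : ∀ i : Fin m, Fin.castAdd 1 i = i.castSucc := fun _ => rfl
    ext i j
    rcases i with i | i <;> rcases j with j | j
    · by_cases hij : i = j <;> simp [hc, h, hA, hij]
    · rw [Subsingleton.elim j 0]
      simp [hc, hl, Fin.castSucc_ne_last]
    · rw [Subsingleton.elim i 0]
      simp [hc, hl, (Fin.castSucc_ne_last _).symm]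
    · rw [Subsingleton.elim i 0, Subsingleton.elim j 0]
      simp [hl]
  change eval t B.charpoly = eval t _
  rw [eval_charpoly, ← det_submatrix_equiv_self (finSumFinEquiv (m := m) (n := 1)), hblock,
    det_fromBlocks₁₁, det_unique (n := Fin 1), hinv, hA, det_diagonal,
    Matrix.sub_apply, mul_apply]
  simp only [of_apply, mul_diagonal, eval_sub, eval_mul, eval_X, eval_C,
    eval_prod, eval_finsetSum, mul_sub, Finset.mul_sum]
  congr 1
  · ring
  · refine Finset.sum_congr rfl fun i _ => ?_
    rw [← Finset.mul_prod_erase _ _ (Finset.mem_univ i)]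
    field_simp [hne i]

theorem eval_charpoly_bordered {m : ℕ} (B : Matrix (Fin (m + 1)) (Fin (m + 1)) ℂ) (μ : Fin m → ℂ)
    (h : ∀ i j : Fin m, B i.castSucc j.castSucc = diagonal μ i j) (i : Fin m) :
    B i.castSucc (Fin.last m) * B (Fin.last m) i.castSucc *
      ∏ j ∈ Finset.univ.erase i, (μ i - μ j) = -B.charpoly.eval (μ i) := by
  rw [charpoly_bordered B μ h]
  have h0 : ∏ j, (μ i - μ j) = 0 := Finset.prod_eq_zero (Finset.mem_univ i) (sub_self _)
  simp only [eval_sub, eval_mul, eval_X, eval_C, eval_prod, eval_finsetSum, h0, mul_zero, zero_sub,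
    neg_neg]
  rw [Finset.sum_eq_single i]
  · intro k _ hk
    rw [Finset.prod_eq_zero (Finset.mem_erase.mpr ⟨hk.symm, Finset.mem_univ i⟩) (sub_self _),
      mul_zero]
  · simp

theorem prod_erase_sub_ne_zero {m : ℕ} {μ : Fin m → ℂ} (hμ : Function.Injective μ) (i : Fin m) :
    ∏ j ∈ Finset.univ.erase i, (μ i - μ j) ≠ 0 :=
  Finset.prod_ne_zero_iff.mpr fun _ hj =>
    sub_ne_zero.mpr fun e => (Finset.ne_of_mem_erase hj) (hμ e).symm

/-- The corner entry of a bordered diagonal matrix is determined by the diagonal and the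
characteristic polynomial. -/
theorem bordered_last_eq {m : ℕ} {B B' : Matrix (Fin (m + 1)) (Fin (m + 1)) ℂ} {μ : Fin m → ℂ}
    (h : ∀ i j : Fin m, B i.castSucc j.castSucc = diagonal μ i j)
    (h' : ∀ i j : Fin m, B' i.castSucc j.castSucc = diagonal μ i j)
    (hB : B.charpoly = B'.charpoly) : B (Fin.last m) (Fin.last m) = B' (Fin.last m) (Fin.last m) := by
  have ht : B.trace = B'.trace := by
    rw [trace_eq_neg_charpoly_coeff, trace_eq_neg_charpoly_coeff, hB]
  simp only [trace, diag_apply, Fin.sum_univ_castSucc, h, h'] at ht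
  exact add_left_cancel ht

/-- A monic polynomial of degree `m + 1` is the characteristic polynomial of a bordered
diagonal matrix with prescribed distinct diagonal entries. -/
theorem exists_bordered {m : ℕ} {μ : Fin m → ℂ} (hμ : Function.Injective μ) {Q : ℂ[X]}
    (hQ : Q.Monic) (hd : Q.natDegree = m + 1) :
    ∃ (u : Fin m → ℂ) (t : ℂ), (X - C t) * ∏ j, (X - C (μ j)) -
      ∑ i, C (u i) * ∏ j ∈ Finset.univ.erase i, (X - C (μ j)) = Q := by
  set P : ℂ[X] := ∏ j, (X - C (μ j)) with hP
  have hPm : P.Monic := monic_prod_of_monic _ _ fun j _ => monic_X_sub_C _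
  have hPd : P.natDegree = m := by
    rw [hP, natDegree_prod_of_monic _ _ fun j _ => monic_X_sub_C _]; simp
  have hne : P.natDegree ≤ Q.natDegree := by omega
  have hR : (Q /ₘ P).Monic := by
    rw [Monic, leadingCoeff_divByMonic_of_monic hPm (by
      rw [degree_eq_natDegree hPm.ne_zero, degree_eq_natDegree hQ.ne_zero]; exact_mod_cast hne)]
    exact hQ
  have hR1 : (Q /ₘ P).natDegree = 1 := by rw [natDegree_divByMonic _ hPm]; omega
  refine ⟨fun i => -Q.eval (μ i) / ∏ j ∈ Finset.univ.erase i, (μ i - μ j), -(Q /ₘ P).coeff 0, ?_⟩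
  have hroot : ∀ i, P.eval (μ i) = 0 := fun i => by
    rw [hP, eval_prod]; exact Finset.prod_eq_zero (Finset.mem_univ i) (by simp)
  have hrem : Q %ₘ P = -∑ i, C (-Q.eval (μ i) / ∏ j ∈ Finset.univ.erase i, (μ i - μ j)) *
      ∏ j ∈ Finset.univ.erase i, (X - C (μ j)) := by
    refine eq_of_degrees_lt_of_eval_index_eq Finset.univ hμ.injOn ?_ ?_ fun i _ => ?_
    · rw [Finset.card_univ, Fintype.card_fin, ← hPd, ← degree_eq_natDegree hPm.ne_zero]
      exact degree_modByMonic_lt _ hPm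
    · rw [degree_neg, Finset.card_univ, Fintype.card_fin]
      refine (degree_sum_le _ _).trans_lt
        ((Finset.sup_lt_iff (WithBot.bot_lt_coe m)).mpr fun i _ => ?_)
      refine (degree_mul_le _ _).trans_lt ((add_le_add_left degree_C_le _).trans_lt ?_)
      rw [zero_add]
      simp only [degree_prod, degree_X_sub_C, Finset.sum_const,
        Finset.card_erase_of_mem (Finset.mem_univ i), Finset.card_univ, Fintype.card_fin, nsmul_eq_mul, mul_one]
      exact Nat.cast_lt.mpr (Nat.sub_lt i.pos one_pos)
    · have h1 := congrArg (eval (μ i)) (modByMonic_add_div Q P)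
      rw [eval_add, eval_mul, hroot, zero_mul, add_zero] at h1
      rw [h1, eval_neg, eval_finsetSum, Finset.sum_eq_single i]
      · rw [eval_mul, eval_C, eval_prod]
        simp only [eval_sub, eval_X, eval_C]
        rw [div_mul_cancel₀ _ (prod_erase_sub_ne_zero hμ i), neg_neg]
      · intro k _ hk
        rw [eval_mul, mul_eq_zero, eval_prod]
        exact Or.inr (Finset.prod_eq_zero (Finset.mem_erase.mpr ⟨hk.symm, Finset.mem_univ i⟩)
          (by simp))
      · simp
  conv_rhs => rw [← modByMonic_add_div Q P, hrem, hR.eq_X_add_C hR1]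
  rw [C_neg, sub_neg_eq_add]
  ring

/-! ### Diagonalization of a corner -/

/-- A matrix with simple spectrum is diagonalizable. -/
theorem exists_eq_conj_diagonal {m : ℕ} (x : M m) {μ : Fin m → ℂ} (hμ : Function.Injective μ)
    (hx : ∀ i, x.charpoly.eval (μ i) = 0) :
    ∃ S T : M m, S * T = 1 ∧ x = S * diagonal μ * T := by
  have hv : ∀ i, ∃ v : Fin m → ℂ, v ≠ 0 ∧ x *ᵥ v = μ i • v := fun i => by
    have h0 := hx i
    rw [eval_charpoly, ← exists_mulVec_eq_zero_iff] at h0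
    obtain ⟨v, hv0, hv⟩ := h0
    refine ⟨v, hv0, ?_⟩
    rw [sub_mulVec, sub_eq_zero] at hv
    rw [← hv]
    ext j
    simp [mulVec_diagonal]
  choose v hv0 hv using hv
  set S : M m := (of v)ᵀ with hS
  have hli : LinearIndependent ℂ S.col :=
    Module.End.eigenvectors_linearIndependent' (toLin' x) μ hμ _ fun i =>
      ⟨Module.End.mem_eigenspace_iff.mpr (by rw [toLin'_apply]; exact hv i), hv0 i⟩
  have hdet : IsUnit S.det := (isUnit_iff_isUnit_det _).mp (linearIndependent_cols_iff_isUnit.mp hli)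
  refine ⟨S, S⁻¹, mul_nonsing_inv _ hdet, ?_⟩
  have hxS : x * S = S * diagonal μ := by
    ext i j
    have := congrFun (hv j) i
    rw [mul_diagonal, mul_comm]
    exact this
  rw [← hxS, mul_assoc, mul_nonsing_inv _ hdet, mul_one]

/-- The vector in `ℂⁿ` whose first `m` coordinates are those of `v`, the others being `w`. -/
def pad {n : ℕ} (m : ℕ) (w : ℂ) (v : Fin m → ℂ) : Fin n → ℂ :=
  fun i => if h : (i : ℕ) < m then v ⟨i, h⟩ else w

/-- `S` and `T` are mutually inverse, respect the corners of size at least `m`, and diagonalize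
the cutoff `x_m`, with eigenvalues `μ`. -/
structure Diagonalizes {n m : ℕ} (μ : Fin m → ℂ) (x S T : M n) : Prop where
  mul_eq_one : S * T = 1
  commute_left : ∀ p, m ≤ p → Commute (idm n p) S
  commute_right : ∀ p, m ≤ p → Commute (idm n p) T
  cutoff_eq : cutoff m x = S * diagonal (pad m 0 μ) * T

/-- An eigenbasis of the corner, extended by the identity matrix. -/
theorem exists_diagonalizes {n m : ℕ} (h : m ≤ n) (x : M n) {μ : Fin m → ℂ}
    (hμ : Function.Injective μ) (hx : ∀ i, (corner h x).charpoly.eval (μ i) = 0) :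
    ∃ S T : M n, Diagonalizes μ x S T := by
  obtain ⟨k, rfl⟩ := Nat.exists_eq_add_of_le h
  obtain ⟨S, T, hST, hxS⟩ := exists_eq_conj_diagonal (corner h x) hμ hx
  let e : Fin (m + k) ≃ Fin m ⊕ Fin k := finSumFinEquiv.symm
  have hidm : ∀ p, m ≤ p → idm (m + k) p =
      (fromBlocks 1 0 0 (diagonal fun j : Fin k => if m + (j : ℕ) < p then 1 else 0)).submatrix
        e e := by
    intro p hp
    ext i j
    refine Fin.addCases (fun i => ?_) (fun i => ?_) i <;>
      refine Fin.addCases (fun j => ?_) (fun j => ?_) j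
    · simp [idm, e, diagonal_apply, one_apply, Fin.ext_iff, i.2.trans_le hp]
    · have : (i : ℕ) ≠ m + j := by omega
      simp [idm, e, Fin.ext_iff, this]
    · have : m + (i : ℕ) ≠ j := by omega
      simp [idm, e, Fin.ext_iff, this]
    · simp [idm, e, diagonal_apply, Fin.ext_iff]
  have hcomm : ∀ (U : M m) (p : ℕ), m ≤ p →
      Commute (idm (m + k) p) ((fromBlocks U 0 0 1).submatrix e e) := by
    intro U p hp
    rw [hidm p hp, Commute, SemiconjBy, submatrix_mul_equiv, submatrix_mul_equiv]
    simp [fromBlocks_multiply]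
  have hcut : cutoff m x = (fromBlocks (corner h x) 0 0 0).submatrix e e := by
    ext i j
    refine Fin.addCases (fun i => ?_) (fun i => ?_) i <;>
      refine Fin.addCases (fun j => ?_) (fun j => ?_) j <;>
      simp [cutoff, e, corner]
    rfl
  have hdiag : diagonal (pad m 0 μ) =
      (fromBlocks (diagonal μ) 0 0 0).submatrix (e : Fin (m + k) → _) e := by
    ext i j
    refine Fin.addCases (fun i => ?_) (fun i => ?_) i <;>
      refine Fin.addCases (fun j => ?_) (fun j => ?_) j
    · simp [pad, e, diagonal_apply]
    · have : (i : ℕ) ≠ m + j := by omega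
      simp [e, Fin.ext_iff, this]
    · have : m + (i : ℕ) ≠ j := by omega
      simp [e, Fin.ext_iff, this]
    · simp [pad, e, diagonal_apply]
  refine ⟨(fromBlocks S 0 0 1).submatrix e e, (fromBlocks T 0 0 1).submatrix e e, ?_, hcomm S,
    hcomm T, ?_⟩
  · rw [submatrix_mul_equiv, fromBlocks_multiply]
    simp [hST]
  · rw [hcut, hxS, hdiag, submatrix_mul_equiv, submatrix_mul_equiv, fromBlocks_multiply,
      fromBlocks_multiply]
    simp

theorem corner_eq_of_cutoff_eq {n m : ℕ} (h : m ≤ n) {x y : M n} (hxy : cutoff m x = cutoff m y) :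
    corner h x = corner h y := by
  rw [← corner_cutoff h x, hxy, corner_cutoff]

theorem cutoff_eq_of_le {n j m : ℕ} (h : j ≤ m) {x y : M n} (hxy : cutoff m x = cutoff m y) :
    cutoff j x = cutoff j y := by
  rw [← cutoff_cutoff h x, hxy, cutoff_cutoff h]

theorem charpoly_corner_conj {n m : ℕ} (h : m ≤ n) (x : M n) {S T : M n} (hTS : T * S = 1)
    (hS : Commute (idm n m) S) (hT : Commute (idm n m) T) :
    (corner h (S * x * T)).charpoly = (corner h x).charpoly := by
  have e : corner h T * corner h S = 1 := by
    rw [← corner_mul h _ _ hT, hTS]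
    ext a b
    simp [corner, one_apply]
  have c3 : corner h (x * T) = corner h x * corner h T := by
    have hE : (idm n m).transpose = idm n m := diagonal_transpose _
    have := corner_mul h T.transpose x.transpose (by
      have := congrArg transpose hT.eq
      simp only [transpose_mul, hE] at this
      exact this.symm)
    rw [← transpose_mul] at this
    exact transpose_injective (this.trans (transpose_mul _ _).symm)
  rw [mul_assoc, corner_mul h _ _ hS, c3, charpoly_mul_comm, mul_assoc, e, mul_one]

namespace Diagonalizes

variable {n m : ℕ} {μ : Fin m → ℂ} {x S T : M n}

theorem mul_eq_one' (H : Diagonalizes μ x S T) : T * S = 1 := mul_eq_one_comm.mp H.mul_eq_one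

theorem congr (H : Diagonalizes μ x S T) {y : M n} (h : cutoff m x = cutoff m y) :
    Diagonalizes μ y S T := { H with cutoff_eq := h ▸ H.cutoff_eq }

theorem cutoff_conj_eq (H : Diagonalizes μ x S T) :
    cutoff m (T * x * S) = diagonal (pad m 0 μ) := by
  rw [cutoff_conj x (H.commute_right m le_rfl) (H.commute_left m le_rfl), H.cutoff_eq]
  calc T * (S * diagonal (pad m 0 μ) * T) * S
      = (T * S) * diagonal (pad m 0 μ) * (T * S) := by simp only [mul_assoc]
    _ = _ := by rw [H.mul_eq_one', one_mul, mul_one]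

theorem conj_conj (H : Diagonalizes μ x S T) (y : M n) : S * (T * y * S) * T = y := by
  calc S * (T * y * S) * T = (S * T) * y * (S * T) := by simp only [mul_assoc]
    _ = y := by rw [H.mul_eq_one, one_mul, mul_one]

theorem charpoly_corner (H : Diagonalizes μ x S T) {p : ℕ} (hp : m ≤ p) (h : p ≤ n) (y : M n) :
    (corner h (T * y * S)).charpoly = (corner h y).charpoly :=
  charpoly_corner_conj h y H.mul_eq_one (H.commute_right p hp) (H.commute_left p hp)

end Diagonalizes

theorem corner_castSucc_castSucc {n m : ℕ} (h : m < n) {B : M n} {μ : Fin m → ℂ}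
    (hB : cutoff m B = diagonal (pad m 0 μ)) (i j : Fin m) :
    corner (Nat.succ_le_of_lt h) B i.castSucc j.castSucc = diagonal μ i j := by
  have := congrFun (congrFun hB (Fin.castLE h.le i)) (Fin.castLE h.le j)
  simp only [cutoff, of_apply, Fin.val_castLE, i.2, j.2, and_self, if_true] at this
  refine this.trans ?_
  simp [diagonal_apply, pad]

/-! ### The flow of one level in eigencoordinates -/

/-- The eigenvalues of `-∑_k z_k x_m ^ (m - k)` as linear functions of `z`, where `μ` are the
eigenvalues of `x_m`. -/
def logEig {m : ℕ} (μ : Fin m → ℂ) : (Fin m → ℂ) →ₗ[ℂ] (Fin m → ℂ) where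
  toFun z i := -∑ k : Fin m, z k * μ i ^ (m - ((k : ℕ) + 1))
  map_add' z w := by
    ext i
    simp only [Pi.add_apply, add_mul, Finset.sum_add_distrib, neg_add]
  map_smul' a z := by
    ext i
    simp only [Pi.smul_apply, smul_eq_mul, mul_assoc, Finset.mul_sum, mul_neg, RingHom.id_apply]

theorem logEig_apply {m : ℕ} (μ z : Fin m → ℂ) (i : Fin m) :
    logEig μ z i = -∑ k : Fin m, z k * μ i ^ (m - ((k : ℕ) + 1)) := rfl

theorem logEig_injective {m : ℕ} {μ : Fin m → ℂ} (hμ : Function.Injective μ) :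
    Function.Injective (logEig μ) := by
  refine (injective_iff_map_eq_zero _).mpr fun z hz => ?_
  have h0 : (fun k => z (Fin.rev k)) = 0 := by
    refine eq_zero_of_forall_index_sum_pow_mul_eq_zero hμ fun i => ?_
    have := neg_eq_zero.mp (congrFun hz i)
    rw [← Equiv.sum_comp Fin.revPerm] at this
    rw [← this]
    refine Finset.sum_congr rfl fun k _ => ?_
    rw [Fin.revPerm_apply, mul_comm, Fin.val_rev]
    congr 2
    omega
  ext k
  simpa using congrFun h0 (Fin.rev k)

theorem exists_exp_logEig_eq {m : ℕ} {μ : Fin m → ℂ} (hμ : Function.Injective μ) (s : Fin m → ℂ)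
    (hs : ∀ i, s i ≠ 0) : ∃ z, ∀ i, Complex.exp (logEig μ z i) = s i := by
  obtain ⟨z, hz⟩ := LinearMap.injective_iff_surjective.mp (logEig_injective hμ)
    fun i => Complex.log (s i)
  exact ⟨z, fun i => by rw [hz, Complex.exp_log (hs i)]⟩

namespace Diagonalizes

variable {n m : ℕ} {μ : Fin m → ℂ} {x S T : M n}

theorem idm_mul_cutoff_pow (H : Diagonalizes μ x S T) (p : ℕ) :
    idm n m * cutoff m x ^ p = S * diagonal (pad m 0 fun i => μ i ^ p) * T := by
  have hp : cutoff m x ^ p = S * diagonal (pad m 0 μ) ^ p * T := by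
    induction p with
    | zero => rw [pow_zero, pow_zero, mul_one, H.mul_eq_one]
    | succ p ih =>
      rw [pow_succ, ih, H.cutoff_eq, pow_succ]
      calc S * diagonal (pad m 0 μ) ^ p * T * (S * diagonal (pad m 0 μ) * T)
          = S * diagonal (pad m 0 μ) ^ p * (T * S) * (diagonal (pad m 0 μ) * T) := by
            simp only [mul_assoc]
        _ = _ := by rw [H.mul_eq_one', mul_one]; simp only [mul_assoc]
  rw [hp, ← mul_assoc, ← mul_assoc, (H.commute_left m le_rfl).eq, mul_assoc S, diagonal_pow, idm,
    diagonal_mul_diagonal]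
  congr 3
  ext i
  by_cases hi : (i : ℕ) < m <;> simp [pad, hi]

theorem rhoLie_eq (H : Diagonalizes μ x S T) (z : Fin m → ℂ) :
    rhoLie m z x = S * diagonal (pad m 0 (logEig μ z)) * T := by
  simp only [rhoLie, H.idm_mul_cutoff_pow]
  have : diagonal (pad m 0 (logEig μ z)) =
      -∑ k : Fin m, z k • diagonal (pad (n := n) m 0 fun i => μ i ^ (m - ((k : ℕ) + 1))) := by
    ext i j
    rw [Matrix.neg_apply, Matrix.sum_apply]
    by_cases hij : i = j
    · subst hij
      by_cases hi : (i : ℕ) < m <;> simp [pad, hi, logEig_apply]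
    · simp [hij]
  rw [this, mul_neg, neg_mul, Finset.mul_sum, Finset.sum_mul]
  simp only [mul_smul_comm, smul_mul_assoc]

theorem rho_eq (H : Diagonalizes μ x S T) (z : Fin m → ℂ) :
    rho m z x = S * diagonal (pad m 1 fun i => Complex.exp (logEig μ z i)) * T := by
  have hinv : S⁻¹ = T := inv_eq_right_inv H.mul_eq_one
  have hunit : IsUnit S := ⟨⟨S, T, H.mul_eq_one, H.mul_eq_one'⟩, rfl⟩
  rw [rho, H.rhoLie_eq, ← hinv, exp_conj _ _ hunit, exp_diagonal]
  congr 3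
  ext i
  rw [Pi.coe_exp, ← Complex.exp_eq_exp_ℂ]
  by_cases hi : (i : ℕ) < m <;> simp [pad, hi]

/-- In the eigenbasis the flow of level `m` conjugates by a diagonal matrix. -/
theorem conj_flow (H : Diagonalizes μ x S T) (z : Fin m → ℂ) :
    T * flow m z x * S = diagonal (pad m 1 fun i => Complex.exp (logEig μ z i)) * (T * x * S) *
      diagonal (pad m 1 fun i => Complex.exp (-logEig μ z i)) := by
  have hneg : (rho m z x)⁻¹ = rho m (-z) x := by
    rw [rho_inv, rho]; simp [rhoLie]
  have hn : ∀ i, logEig μ (-z) i = -logEig μ z i := fun i => by rw [map_neg]; rfl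
  rw [flow, hneg, H.rho_eq, H.rho_eq]
  simp only [hn]
  set D := diagonal (pad (n := n) m 1 fun i => Complex.exp (logEig μ z i))
  set D' := diagonal (pad (n := n) m 1 fun i => Complex.exp (-logEig μ z i))
  calc T * (S * D * T * x * (S * D' * T)) * S
      = (T * S) * D * (T * x * S) * D' * (T * S) := by simp only [mul_assoc]
    _ = _ := by rw [H.mul_eq_one', one_mul, mul_one]

theorem flow_eq_self (H : Diagonalizes μ x S T) {z : Fin m → ℂ}
    (hz : ∀ i, Complex.exp (logEig μ z i) = 1) : flow m z x = x := by
  have h1 : rho m z x = 1 := by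
    have : pad m 1 (fun i => Complex.exp (logEig μ z i)) = (1 : Fin n → ℂ) := by
      ext i
      by_cases hi : (i : ℕ) < m <;> simp [pad, hi, hz]
    rw [H.rho_eq, this, diagonal_one', mul_one, H.mul_eq_one]
  rw [flow, h1, inv_one, one_mul, mul_one]

end Diagonalizes

theorem cutoff_eq_of_corner_eq {n m : ℕ} (h : m ≤ n) {x y : M n} (hxy : corner h x = corner h y) :
    cutoff m x = cutoff m y := by
  ext i j
  simp only [cutoff, of_apply]
  split_ifs with hij
  · exact congrFun (congrFun hxy ⟨i, hij.1⟩) ⟨j, hij.2⟩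
  · rfl

theorem corner_diagonal_mul_mul {n m : ℕ} (h : m < n) (s t : Fin m → ℂ) (B : M n) :
    corner (Nat.succ_le_of_lt h) (diagonal (pad m 1 s) * B * diagonal (pad m 1 t)) =
      diagonal (Fin.snoc s (1 : ℂ) : Fin (m + 1) → ℂ) * corner (Nat.succ_le_of_lt h) B *
        diagonal (Fin.snoc t (1 : ℂ) : Fin (m + 1) → ℂ) := by
  have hpad : ∀ (v : Fin m → ℂ) (i : Fin (m + 1)),
      pad m 1 v (Fin.castLE (Nat.succ_le_of_lt h) i) = (Fin.snoc v (1 : ℂ) : Fin (m + 1) → ℂ) i := by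
    intro v i
    refine Fin.lastCases ?_ (fun i => ?_) i <;> simp [pad]
  ext i j
  simp only [corner, submatrix_apply, mul_diagonal, diagonal_mul, hpad]

section step

variable {n m : ℕ} {μ : Fin m → ℂ}

/-- Two matrices with the same cutoff `x_m` and isospectral corners of size `m + 1` differ, up to
that size, by the flow of level `m`. -/
theorem exists_cutoff_flow_eq (h : m < n) (hμ : Function.Injective μ) {x y : M n}
    (hx : ∀ i, (corner h.le x).charpoly.eval (μ i) = 0) (hxy : cutoff m x = cutoff m y)
    (hQ : (corner (Nat.succ_le_of_lt h) x).charpoly = (corner (Nat.succ_le_of_lt h) y).charpoly)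
    (hne : ∀ i, (corner (Nat.succ_le_of_lt h) x).charpoly.eval (μ i) ≠ 0) :
    ∃ z, cutoff (m + 1) (flow m z x) = cutoff (m + 1) y := by
  obtain ⟨S, T, H⟩ := exists_diagonalizes h.le x hμ hx
  set B : Matrix (Fin (m + 1)) (Fin (m + 1)) ℂ := corner (Nat.succ_le_of_lt h) (T * x * S) with hB
  set B' : Matrix (Fin (m + 1)) (Fin (m + 1)) ℂ := corner (Nat.succ_le_of_lt h) (T * y * S) with hB'
  have hBd : ∀ i j : Fin m, B i.castSucc j.castSucc = diagonal μ i j :=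
    corner_castSucc_castSucc h H.cutoff_conj_eq
  have hBd' : ∀ i j : Fin m, B' i.castSucc j.castSucc = diagonal μ i j :=
    corner_castSucc_castSucc h (H.congr hxy).cutoff_conj_eq
  have hBc := H.charpoly_corner (Nat.le_succ m) (Nat.succ_le_of_lt h) x
  have hBc' := H.charpoly_corner (Nat.le_succ m) (Nat.succ_le_of_lt h) y
  have e := eval_charpoly_bordered B μ hBd
  have e' := eval_charpoly_bordered B' μ hBd'
  rw [hBc] at e
  rw [hBc', ← hQ] at e'
  have hprod : ∀ i : Fin m, B i.castSucc (Fin.last m) * B (Fin.last m) i.castSucc =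
      B' i.castSucc (Fin.last m) * B' (Fin.last m) i.castSucc := fun i =>
    mul_right_cancel₀ (prod_erase_sub_ne_zero hμ i) ((e i).trans (e' i).symm)
  have hB0 : ∀ i : Fin m, B i.castSucc (Fin.last m) * B (Fin.last m) i.castSucc ≠ 0 := fun i h0 =>
    hne i (neg_eq_zero.mp (by rw [← e i, h0, zero_mul]))
  have hu : ∀ i : Fin m, B i.castSucc (Fin.last m) ≠ 0 := fun i => left_ne_zero_of_mul (hB0 i)
  have hu' : ∀ i : Fin m, B' i.castSucc (Fin.last m) ≠ 0 := fun i =>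
    left_ne_zero_of_mul (hprod i ▸ hB0 i)
  obtain ⟨z, hz⟩ := exists_exp_logEig_eq hμ
    (fun i => B' i.castSucc (Fin.last m) / B i.castSucc (Fin.last m))
    fun i => div_ne_zero (hu' i) (hu i)
  have hcorner : corner (Nat.succ_le_of_lt h) (T * flow m z x * S) = B' := by
    rw [H.conj_flow, corner_diagonal_mul_mul h, ← hB]
    ext i j
    simp only [mul_diagonal, diagonal_mul]
    refine Fin.lastCases ?_ (fun i => ?_) i <;> refine Fin.lastCases ?_ (fun j => ?_) j
    · simp [bordered_last_eq hBd hBd' (hBc.trans (hQ.trans hBc'.symm))]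
    · simp only [Fin.snoc_last, Fin.snoc_castSucc, one_mul, Complex.exp_neg, hz]
      rw [inv_div, mul_div_assoc', div_eq_iff (hu' j), mul_comm, hprod, mul_comm]
    · simp only [Fin.snoc_last, Fin.snoc_castSucc, mul_one, hz]
      rw [div_mul_cancel₀ _ (hu i)]
    · simp only [Fin.snoc_castSucc, Complex.exp_neg]
      rw [hBd, hBd']
      by_cases hij : i = j
      · subst hij
        rw [mul_right_comm, mul_inv_cancel₀ (Complex.exp_ne_zero _), one_mul]
      · simp [hij]
  refine ⟨z, ?_⟩
  have hS := H.commute_left (m + 1) (Nat.le_succ m)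
  have hT := H.commute_right (m + 1) (Nat.le_succ m)
  rw [← H.conj_conj (flow m z x), ← H.conj_conj y, cutoff_conj (T * flow m z x * S) hS hT,
    cutoff_conj (T * y * S) hS hT, cutoff_eq_of_corner_eq (Nat.succ_le_of_lt h) hcorner]

/-- An element of `A(m)` that fixes a point up to size `m + 1` acts trivially. -/
theorem exp_logEig_eq_one (h : m < n) (hμ : Function.Injective μ) {x : M n}
    (hx : ∀ i, (corner h.le x).charpoly.eval (μ i) = 0)
    (hne : ∀ i, (corner (Nat.succ_le_of_lt h) x).charpoly.eval (μ i) ≠ 0) {z : Fin m → ℂ}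
    (hz : cutoff (m + 1) (flow m z x) = cutoff (m + 1) x) (i : Fin m) :
    Complex.exp (logEig μ z i) = 1 := by
  obtain ⟨S, T, H⟩ := exists_diagonalizes h.le x hμ hx
  set B : Matrix (Fin (m + 1)) (Fin (m + 1)) ℂ := corner (Nat.succ_le_of_lt h) (T * x * S) with hB
  have hBd : ∀ i j : Fin m, B i.castSucc j.castSucc = diagonal μ i j :=
    corner_castSucc_castSucc h H.cutoff_conj_eq
  have e := eval_charpoly_bordered B μ hBd i
  rw [H.charpoly_corner (Nat.le_succ m) (Nat.succ_le_of_lt h) x] at e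
  have hu : B i.castSucc (Fin.last m) ≠ 0 := fun h0 =>
    hne i (neg_eq_zero.mp (by rw [← e, h0, zero_mul, zero_mul]))
  have hS := H.commute_left (m + 1) (Nat.le_succ m)
  have hT := H.commute_right (m + 1) (Nat.le_succ m)
  have hc : corner (Nat.succ_le_of_lt h) (T * flow m z x * S) = B :=
    corner_eq_of_cutoff_eq _ (by rw [cutoff_conj _ hT hS, hz, cutoff_conj _ hT hS])
  rw [H.conj_flow, corner_diagonal_mul_mul h, ← hB] at hc
  have := congrFun (congrFun hc i.castSucc) (Fin.last m)
  simp only [mul_diagonal, diagonal_mul, Fin.snoc_last, Fin.snoc_castSucc, mul_one] at this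
  exact mul_right_cancel₀ hu (this.trans (one_mul _).symm)

/-- A matrix whose corner of size `m` has simple spectrum can be changed outside of that corner so
that the characteristic polynomial of the corner of size `m + 1` is any given one. -/
theorem exists_charpoly_corner_eq (h : m < n) (hμ : Function.Injective μ) {x : M n}
    (hx : ∀ i, (corner h.le x).charpoly.eval (μ i) = 0) {Q : ℂ[X]} (hQ : Q.Monic)
    (hd : Q.natDegree = m + 1) :
    ∃ y : M n, cutoff m y = cutoff m x ∧ (corner (Nat.succ_le_of_lt h) y).charpoly = Q := by
  obtain ⟨S, T, H⟩ := exists_diagonalizes h.le x hμ hx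
  obtain ⟨u, t, hut⟩ := exists_bordered hμ hQ hd
  -- The bordered diagonal matrix with last column `u` and last row `1`.
  set B : M n := of fun i j => if (j : ℕ) < m then if (i : ℕ) < m then
      diagonal (pad m 0 μ) i j else 1 else if (i : ℕ) < m then pad m 0 u i else t with hB
  have hBd : cutoff m B = diagonal (pad m 0 μ) := by
    ext i j
    by_cases hij : i = j
    · subst hij
      by_cases hi : (i : ℕ) < m <;> simp [cutoff, hB, hi, pad]
    · simp only [cutoff, hB, of_apply, diagonal_apply_ne _ hij]
      grind
  have hBc : (corner (Nat.succ_le_of_lt h) B).charpoly = Q := by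
    rw [charpoly_bordered _ μ (corner_castSucc_castSucc h hBd), ← hut]
    simp [corner, hB, pad]
  refine ⟨S * B * T, ?_, ?_⟩
  · rw [cutoff_conj B (H.commute_left m le_rfl) (H.commute_right m le_rfl), hBd, H.cutoff_eq]
  · rw [charpoly_corner_conj _ B H.mul_eq_one' (H.commute_left _ (Nat.le_succ m))
      (H.commute_right _ (Nat.le_succ m)), hBc]

end step

/-! ### Eigenvalues of the corners on a fiber -/

section levelPoly

variable {n : ℕ} (c : Idx n → ℂ) (m : Fin n)

theorem levelPoly_monic : (levelPoly c m).Monic := by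
  rw [levelPoly]
  exact monic_X_pow_add (degree_sum_fin_lt _)

theorem natDegree_levelPoly : (levelPoly c m).natDegree = m + 1 := by
  rw [levelPoly]
  exact natDegree_eq_of_degree_eq_some (by
    rw [degree_add_eq_left_of_degree_lt] <;> rw [degree_X_pow]
    exact degree_sum_fin_lt _)

theorem coeff_levelPoly (k : Fin ((m : ℕ) + 1)) :
    (levelPoly c m).coeff k = (-1) ^ ((m : ℕ) + 1 - (k : ℕ)) * c ⟨m, k⟩ := by
  have hk : (k : ℕ) ≠ m + 1 := k.2.ne
  rw [levelPoly, coeff_add, coeff_X_pow, if_neg hk, zero_add, finsetSum_coeff]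
  simp only [coeff_C_mul, coeff_X_pow, Fin.val_inj]
  rw [Finset.sum_eq_single k]
  · simp
  · intro j _ hj
    simp [hj.symm]
  · simp

end levelPoly

variable {n : ℕ} {c : Idx n → ℂ}

theorem mem_fiber_iff {x : M n} :
    x ∈ fiber n c ↔
      ∀ m : Fin n, (corner (Nat.succ_le_of_lt m.2) x).charpoly = levelPoly c m := by
  refine ⟨fun hx m => ?_, fun hx => ?_⟩
  · rw [← levelPoly_Phi, show Phi x = c from hx]
  · change Phi x = c
    ext ⟨m, k⟩
    change (-1) ^ ((m : ℕ) + 1 - (k : ℕ)) * (corner _ x).charpoly.coeff k = _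
    rw [hx m, coeff_levelPoly, ← mul_assoc, ← mul_pow]
    simp

/-- A choice of `m` distinct roots `μ m` of the polynomial that `c` prescribes for the corner of
size `m`, none of them a root of the polynomial for the corner of size `m + 1`. Sizes beyond `n` are
unconstrained. -/
structure IsSpectrum (c : Idx n → ℂ) (μ : ∀ m : ℕ, Fin m → ℂ) : Prop where
  injective : ∀ m ≤ n, Function.Injective (μ m)
  eval_eq_zero : ∀ (m : Fin n) i, (levelPoly c m).eval (μ (m + 1) i) = 0
  eval_ne_zero : ∀ (m : Fin n) i, (levelPoly c m).eval (μ m i) ≠ 0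

theorem exists_isSpectrum (hc : c ∈ Omega n) : ∃ μ, IsSpectrum c μ := by
  have hν : ∀ m : Fin n, ∃ ν : Fin ((m : ℕ) + 1) → ℂ, Function.Injective ν ∧
      ∀ i, ν i ∈ eigs c m := by
    intro m
    have hcard : (eigs c m).toFinset.card = (m : ℕ) + 1 := by
      rw [Multiset.toFinset_card_of_nodup (hc.1 m), eigs,
        ← (IsAlgClosed.splits (levelPoly c m)).natDegree_eq_card_roots, natDegree_levelPoly]
    let e := (Finset.equivFinOfCardEq hcard).symm
    exact ⟨fun i => e i, Subtype.val_injective.comp e.injective,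
      fun i => Multiset.mem_toFinset.mp (e i).2⟩
  choose ν hinj hmem using hν
  refine ⟨fun m => match m with
    | 0 => Fin.elim0
    | m + 1 => if h : m < n then ν ⟨m, h⟩ else 0, ?_, ?_, ?_⟩
  · rintro (_ | m) hm
    · exact Function.injective_of_subsingleton _
    · simpa only [dif_pos (show m < n from hm)] using hinj ⟨m, hm⟩
  · intro m i
    simp only [dif_pos m.2]
    exact (mem_roots'.mp (hmem m i)).2
  · rintro ⟨_ | m, hm⟩ i
    · exact i.elim0
    · have hm' : m < n := Nat.lt_of_succ_lt hm
      simp only [dif_pos hm']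
      intro h0
      exact Multiset.disjoint_left.mp (hc.2 ⟨m, hm'⟩ ⟨m + 1, hm⟩ rfl) (hmem ⟨m, hm'⟩ i)
        (mem_roots'.mpr ⟨(levelPoly_monic _ _).ne_zero, h0⟩)

namespace IsSpectrum

variable {μ : ∀ m : ℕ, Fin m → ℂ} (hμ : IsSpectrum c μ)

include hμ

theorem eval_charpoly_eq_zero {m : ℕ} (h : m ≤ n) {x : M n}
    (hx : ∀ p : Fin n, (p : ℕ) < m →
      (corner (Nat.succ_le_of_lt p.2) x).charpoly = levelPoly c p) (i : Fin m) :
    (corner h x).charpoly.eval (μ m i) = 0 := by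
  rcases m with _ | m
  · exact i.elim0
  · exact (congrArg (eval _) (hx ⟨m, h⟩ (Nat.lt_succ_self m))).trans (hμ.eval_eq_zero ⟨m, h⟩ i)

theorem fiber_nonempty : (fiber n c).Nonempty := by
  have key : ∀ m ≤ n, ∃ x : M n, ∀ p : Fin n, (p : ℕ) < m →
      (corner (Nat.succ_le_of_lt p.2) x).charpoly = levelPoly c p := by
    intro m
    induction m with
    | zero => exact fun _ => ⟨0, fun p hp => absurd hp (Nat.not_lt_zero _)⟩
    | succ m ih =>
      intro hm
      obtain ⟨x, hx⟩ := ih (Nat.le_of_succ_le hm)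
      obtain ⟨y, hyx, hy⟩ := exists_charpoly_corner_eq hm (hμ.injective m (Nat.le_of_succ_le hm))
        (hμ.eval_charpoly_eq_zero (Nat.le_of_succ_le hm) hx) (levelPoly_monic c ⟨m, hm⟩)
        (natDegree_levelPoly c ⟨m, hm⟩)
      refine ⟨y, fun p hp => ?_⟩
      rcases Nat.lt_succ_iff_lt_or_eq.mp hp with hp | hp
      · rw [corner_eq_of_cutoff_eq _ (cutoff_eq_of_le (Nat.succ_le_of_lt hp) hyx), hx p hp]
      · obtain rfl : p = ⟨m, hm⟩ := Fin.ext hp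
        exact hy
  obtain ⟨x, hx⟩ := key n le_rfl
  exact ⟨x, mem_fiber_iff.mpr fun m => hx m m.2⟩

end IsSpectrum

/-! ### The orbits of `A` on a fiber -/

theorem act_mem_fiber (a : A n) {x : M n} (hx : x ∈ fiber n c) : act a x ∈ fiber n c :=
  (Phi_act a x).trans hx

/-- The element of `A` with component `z` in the factor of index `m`, which is `A(m+1)`, and trivial
otherwise. -/
def levelSingle (m : Fin (n - 1)) (z : Fin ((m : ℕ) + 1) → ℂ) : A n := fun i =>
  (Pi.single m z : (p : Fin (n - 1)) → Fin ((p : ℕ) + 1) → ℂ) i.1 i.2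

theorem act_levelSingle (m : Fin (n - 1)) (z : Fin ((m : ℕ) + 1) → ℂ) (x : M n) :
    act (levelSingle m z) x = flow ((m : ℕ) + 1) z x := by
  have hne : ∀ p : Fin (n - 1), p ≠ m → (fun j => levelSingle m z ⟨p, j⟩) = 0 := fun p hp => by
    ext j
    simp only [levelSingle, Pi.single_eq_of_ne hp]
  have heq : (fun j => levelSingle m z ⟨m, j⟩) = z := by
    ext j
    simp only [levelSingle, Pi.single_eq_same]
  have key : ∀ l : List (Fin (n - 1)), l.Nodup →
      l.foldr (fun (p : Fin (n - 1)) y => flow ((p : ℕ) + 1)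
        (fun j => levelSingle m z ⟨p, j⟩) y) x = if m ∈ l then flow ((m : ℕ) + 1) z x else x := by
    intro l hl
    induction l with
    | nil => simp
    | cons p l ih =>
      obtain ⟨hpl, hl'⟩ := List.nodup_cons.mp hl
      rw [List.foldr_cons, ih hl']
      by_cases hp : p = m
      · subst hp
        rw [if_neg hpl, if_pos List.mem_cons_self, heq]
      · rw [hne p hp, flow_zero]
        simp [List.mem_cons, Ne.symm hp]
  rw [act, key _ (List.nodup_finRange _), if_pos (List.mem_finRange m)]

theorem exists_act_eq_flow {m : ℕ} (hm : m < n) (z : Fin m → ℂ) :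
    ∃ a : A n, ∀ x, act a x = flow m z x := by
  rcases m with _ | m
  · exact ⟨0, fun x => by rw [act_zero, Subsingleton.elim z 0, flow_zero]⟩
  · have hm' : m < n - 1 := Nat.lt_sub_of_add_lt hm
    exact ⟨levelSingle ⟨m, hm'⟩ z, fun x => act_levelSingle ⟨m, hm'⟩ z x⟩

theorem cutoff_self (x : M n) : cutoff n x = x := by
  ext i j
  simp [cutoff]

/-- The logarithmic eigenvalues of all the levels, as a linear map on `A`. -/
def logEigs (n : ℕ) (μ : ∀ m : ℕ, Fin m → ℂ) : A n →ₗ[ℂ] A n :=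
  LinearMap.pi fun i => LinearMap.proj i.2 ∘ₗ logEig (μ (i.1 + 1)) ∘ₗ
    LinearMap.funLeft ℂ ℂ fun k => (⟨i.1, k⟩ : Idx (n - 1))

theorem logEigs_apply (μ : ∀ m : ℕ, Fin m → ℂ) (a : A n) (m : Fin (n - 1))
    (i : Fin ((m : ℕ) + 1)) :
    logEigs n μ a ⟨m, i⟩ = logEig (μ (m + 1)) (fun k => a ⟨m, k⟩) i := rfl

namespace IsSpectrum

variable {μ : ∀ m : ℕ, Fin m → ℂ} (hμ : IsSpectrum c μ)

include hμ

theorem logEigs_injective : Function.Injective (logEigs n μ) := by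
  intro a b hab
  ext ⟨m, k⟩
  refine congrFun (logEig_injective (hμ.injective (m + 1) (by omega))
    (a₁ := fun k => a ⟨m, k⟩) (a₂ := fun k => b ⟨m, k⟩) ?_) k
  ext i
  exact congrFun hab ⟨m, i⟩

theorem eval_charpoly_corner {x : M n} (hx : x ∈ fiber n c) {m : ℕ} (h : m ≤ n) (i : Fin m) :
    (corner h x).charpoly.eval (μ m i) = 0 :=
  hμ.eval_charpoly_eq_zero h (fun p _ => mem_fiber_iff.mp hx p) i

theorem eval_charpoly_corner_succ {x : M n} (hx : x ∈ fiber n c) {m : ℕ} (h : m < n)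
    (i : Fin m) : (corner (Nat.succ_le_of_lt h) x).charpoly.eval (μ m i) ≠ 0 := by
  have := hμ.eval_ne_zero ⟨m, h⟩ i
  rwa [← mem_fiber_iff.mp hx] at this

theorem exists_act_eq {x y : M n} (hx : x ∈ fiber n c) (hy : y ∈ fiber n c) :
    ∃ a : A n, act a x = y := by
  have key : ∀ m ≤ n, ∃ a : A n, cutoff m (act a x) = cutoff m y := by
    intro m
    induction m with
    | zero => exact fun _ => ⟨0, by ext i j; simp [cutoff]⟩
    | succ m ih =>
      intro hm
      obtain ⟨a, ha⟩ := ih (Nat.le_of_succ_le hm)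
      have hax := act_mem_fiber a hx
      obtain ⟨z, hz⟩ := exists_cutoff_flow_eq hm (hμ.injective m (Nat.le_of_succ_le hm))
        (hμ.eval_charpoly_corner hax _) ha
        ((mem_fiber_iff.mp hax ⟨m, hm⟩).trans (mem_fiber_iff.mp hy ⟨m, hm⟩).symm)
        (hμ.eval_charpoly_corner_succ hax hm)
      obtain ⟨b, hb⟩ := exists_act_eq_flow hm z
      exact ⟨b + a, by rw [act_add, hb, hz]⟩
  obtain ⟨a, ha⟩ := key n le_rfl
  exact ⟨a, by rwa [cutoff_self, cutoff_self] at ha⟩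

theorem flow_eq_self {x : M n} (hx : x ∈ fiber n c) {m : ℕ} (hm : m ≤ n) {z : Fin m → ℂ}
    (hz : ∀ i, Complex.exp (logEig (μ m) z i) = 1) : flow m z x = x := by
  obtain ⟨S, T, H⟩ := exists_diagonalizes hm x (hμ.injective m hm) (hμ.eval_charpoly_corner hx hm)
  exact H.flow_eq_self hz

theorem act_eq_self {a : A n} (ha : ∀ i, Complex.exp (logEigs n μ a i) = 1) {x : M n}
    (hx : x ∈ fiber n c) : act a x = x := by
  unfold act
  induction List.finRange (n - 1) with
  | nil => rfl
  | cons m l ih =>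
    have hm : (m : ℕ) + 1 ≤ n := by omega
    rw [List.foldr_cons, ih]
    exact hμ.flow_eq_self hx hm fun i => by rw [← logEigs_apply]; exact ha _

/-- The stabilizer of a point: the factors of `A` are treated by increasing size of the corner. -/
theorem exp_logEigs_eq_one {a : A n} {x : M n} (hx : x ∈ fiber n c) (ha : act a x = x)
    (i : Idx (n - 1)) : Complex.exp (logEigs n μ a i) = 1 := by
  suffices key : ∀ (m : Fin (n - 1)) (i : Fin ((m : ℕ) + 1)),
      Complex.exp (logEig (μ (m + 1)) (fun k => a ⟨m, k⟩) i) = 1 by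
    obtain ⟨m, i⟩ := i
    rw [logEigs_apply]
    exact key m i
  intro m
  induction m using WellFoundedLT.induction with
  | _ m ih =>
  intro i
  have hm : (m : ℕ) + 1 < n := by omega
  set z : Fin ((m : ℕ) + 1) → ℂ := fun k => a ⟨m, k⟩ with hz
  set b : A n := a - levelSingle m z with hb
  -- Index `m` stands for `A(m+1)`, so the relevant corner has size `m + 2`: the smaller factors of
  -- `a` act trivially by induction, the larger ones do not move this corner.
  have hcut : cutoff ((m : ℕ) + 1 + 1) (act b x) = cutoff ((m : ℕ) + 1 + 1) x := by
    unfold act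
    induction List.finRange (n - 1) with
    | nil => rfl
    | cons p l ihl =>
      rw [List.foldr_cons]
      set y := l.foldr (fun (m : Fin (n - 1)) y => flow ((m : ℕ) + 1) (fun k => b ⟨m, k⟩) y) x
      have hy : y ∈ fiber n c := by
        have : ∀ l : List (Fin (n - 1)), l.foldr (fun (m : Fin (n - 1)) y =>
            flow ((m : ℕ) + 1) (fun k => b ⟨m, k⟩) y) x ∈ fiber n c := by
          intro l
          induction l with
          | nil => exact hx
          | cons q l ih => exact (Phi_flow _ _).trans ih
        exact this l
      rcases lt_trichotomy p m with h | h | h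
      · have hbp : (fun k => b ⟨p, k⟩) = fun k => a ⟨p, k⟩ := by
          ext k
          simp [hb, levelSingle, Pi.single_eq_of_ne h.ne]
        have hp : (p : ℕ) + 1 ≤ n := by omega
        rw [hbp, hμ.flow_eq_self hy hp (ih p h), ihl]
      · subst h
        have hbp : (fun k => b ⟨p, k⟩) = 0 := by
          ext k
          simp [hb, levelSingle, hz]
        rw [hbp, flow_zero, ihl]
      · rw [cutoff_flow (Nat.succ_le_succ h), ihl]
  have hflow : flow ((m : ℕ) + 1) z (act b x) = x := by
    rw [← act_levelSingle m z, ← act_add, hb, add_sub_cancel, ha]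
  have hbx := act_mem_fiber b hx
  exact exp_logEig_eq_one hm (hμ.injective _ hm.le)
    (hμ.eval_charpoly_corner hbx hm.le) (hμ.eval_charpoly_corner_succ hbx hm)
    ((congrArg _ hflow).trans hcut.symm) i

theorem mem_D_iff {a : A n} : a ∈ D n c ↔ ∀ i, Complex.exp (logEigs n μ a i) = 1 := by
  refine ⟨fun ha => ?_, fun ha x => Subtype.ext (hμ.act_eq_self ha x.2)⟩
  obtain ⟨x, hx⟩ := hμ.fiber_nonempty
  exact hμ.exp_logEigs_eq_one hx (congrArg Subtype.val (ha ⟨x, hx⟩))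

theorem mem_D_iff_act_eq {a : A n} {x : M n} (hx : x ∈ fiber n c) : a ∈ D n c ↔ act a x = x :=
  ⟨fun ha => congrArg Subtype.val (ha ⟨x, hx⟩),
    fun ha => hμ.mem_D_iff.mpr (hμ.exp_logEigs_eq_one hx ha)⟩

theorem existsUnique_vadd_eq (x y : fiber n c) : ∃! a : Ac n c, a +ᵥ x = y := by
  obtain ⟨a, ha⟩ := hμ.exists_act_eq x.2 y.2
  refine ⟨a, Subtype.ext ha, fun b hb => ?_⟩
  induction b using QuotientAddGroup.induction_on with
  | H b =>
    refine QuotientAddGroup.eq.mpr ((hμ.mem_D_iff_act_eq x.2).mpr ?_)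
    have hb' : act b x.1 = y.1 := congrArg Subtype.val hb
    rw [act_add, ha, ← hb', ← act_add, neg_add_cancel, act_zero]

end IsSpectrum

/-! ### `A_c` as a complex torus -/

/-- Exponentiation of the logarithmic eigenvalues, as a homomorphism from `A` to a torus. -/
noncomputable def torusHom (n : ℕ) (μ : ∀ m : ℕ, Fin m → ℂ) :
    A n →+ Additive (Idx (n - 1) → ℂˣ) where
  toFun a := Additive.ofMul fun i =>
    Units.mk0 (Complex.exp (logEigs n μ a i)) (Complex.exp_ne_zero _)
  map_zero' := by
    refine congrArg Additive.ofMul (funext fun i => Units.ext ?_)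
    simp
  map_add' a b := by
    refine congrArg Additive.ofMul (funext fun i => Units.ext ?_)
    change Complex.exp _ = Complex.exp _ * Complex.exp _
    rw [map_add, Pi.add_apply, Complex.exp_add]

theorem coe_torusHom {n : ℕ} (μ : ∀ m : ℕ, Fin m → ℂ) (a : A n) (i : Idx (n - 1)) :
    (((torusHom n μ a).toMul i : ℂˣ) : ℂ) = Complex.exp (logEigs n μ a i) := rfl

/-- The elements of order at most two of a torus are the points with coordinates `±1`. -/
theorem natCard_F {n : ℕ} {c : Idx n → ℂ} (φ : Ac n c ≃+ Additive (Idx (n - 1) → ℂˣ)) :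
    Nat.card (F n c) = 2 ^ d (n - 1) := by
  -- The sign vectors, transported along `φ`.
  let g : (Idx (n - 1) → ℤˣ) → F n c := fun ε =>
    ⟨φ.symm (Additive.ofMul fun i => Units.map (Int.castRingHom ℂ : ℤ →* ℂ) (ε i)), by
      change φ.symm _ + φ.symm _ = 0
      rw [← map_add, ← ofMul_mul, EmbeddingLike.map_eq_zero_iff, ofMul_eq_zero]
      ext i
      rw [Pi.mul_apply, ← map_mul, Int.units_mul_self, map_one, Pi.one_apply]⟩
  have hg : Function.Bijective g := by
    refine ⟨fun ε ε' h => ?_, fun f => ?_⟩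
    · have h1 := Additive.ofMul.injective (φ.symm.injective (congrArg Subtype.val h))
      ext i
      have h2 := congrArg Units.val (congrFun h1 i)
      simpa using h2
    · obtain ⟨f, hf⟩ := f
      have hsq : ∀ i, (φ f).toMul i = 1 ∨ (φ f).toMul i = -1 := fun i => by
        have h0 : φ f + φ f = 0 := by rw [← map_add, show f + f = 0 from hf, map_zero]
        have h1 : ((φ f).toMul i : ℂˣ) * (φ f).toMul i = 1 :=
          congrFun (congrArg Additive.toMul h0) i
        have h2 := mul_self_eq_one_iff.mp (congrArg Units.val h1)
        exact h2.imp (fun h => Units.ext h) fun h => Units.ext h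
      classical
      refine ⟨fun i => if (φ f).toMul i = 1 then 1 else -1, Subtype.ext ?_⟩
      refine (AddEquiv.symm_apply_eq φ).mpr ?_
      refine Additive.toMul.injective (funext fun i => ?_)
      change Units.map (Int.castRingHom ℂ : ℤ →* ℂ) (if (φ f).toMul i = 1 then 1 else -1) =
        (φ f).toMul i
      split_ifs with h
      · rw [map_one, h]
      · rw [(hsq i).resolve_left h]
        ext
        simp
  rw [← Nat.card_eq_of_bijective g hg, Nat.card_fun, ← card_idx, Nat.card_eq_fintype_card,
    Nat.card_eq_fintype_card, Fintype.card_units_int]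

namespace IsSpectrum

variable {n : ℕ} {c : Idx n → ℂ} {μ : ∀ m : ℕ, Fin m → ℂ} (hμ : IsSpectrum c μ)

include hμ

theorem exists_torus : ∃ (L : A n ≃ₗ[ℂ] (Idx (n - 1) → ℂ))
    (φ : Ac n c ≃+ Additive (Idx (n - 1) → ℂˣ)), ∀ (a : A n) (i : Idx (n - 1)),
      (((φ (a : Ac n c)).toMul i : ℂˣ) : ℂ) = Complex.exp (L a i) := by
  let L : A n ≃ₗ[ℂ] A n := LinearEquiv.ofInjectiveEndo (logEigs n μ) hμ.logEigs_injective
  have hL : ∀ a, L a = logEigs n μ a := fun a => rfl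
  have hsurj : Function.Surjective (torusHom n μ) := fun u => by
    refine ⟨L.symm fun i => Complex.log (u.toMul i : ℂ), ?_⟩
    refine Additive.toMul.injective (funext fun i => Units.ext ?_)
    rw [coe_torusHom, ← hL, LinearEquiv.apply_symm_apply, Complex.exp_log (Units.ne_zero _)]
  have hker : D n c = (torusHom n μ).ker := by
    ext a
    rw [hμ.mem_D_iff, AddMonoidHom.mem_ker, ← Additive.toMul.injective.eq_iff, funext_iff]
    exact forall_congr' fun i =>
      ⟨fun h => Units.ext h, fun h => congrArg Units.val h⟩
  refine ⟨L, (QuotientAddGroup.quotientAddEquivOfEq hker).trans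
    (QuotientAddGroup.quotientKerEquivOfSurjective _ hsurj), fun a i => rfl⟩

end IsSpectrum

/-! ### Symmetric matrices -/

section transpose

variable {n : ℕ} {c : Idx n → ℂ}

theorem transpose_cutoff (m : ℕ) (x : M n) : (cutoff m x)ᵀ = cutoff m xᵀ := by
  ext i j
  simp only [cutoff, transpose_apply, of_apply, and_comm]

theorem transpose_rhoLie {m : ℕ} (z : Fin m → ℂ) (x : M n) : (rhoLie m z x)ᵀ = rhoLie m z xᵀ := by
  have hE : (idm n m)ᵀ = idm n m := diagonal_transpose _
  simp only [rhoLie, transpose_neg, transpose_sum, transpose_smul, transpose_mul, transpose_pow,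
    transpose_cutoff, hE, ((commute_idm_cutoff le_rfl xᵀ).pow_right _).eq]

theorem transpose_flow {m : ℕ} (z : Fin m → ℂ) (x : M n) : (flow m z x)ᵀ = flow m (-z) xᵀ := by
  have h1 : rho m (-z) xᵀ = ((rho m z x)⁻¹)ᵀ := by
    rw [rho_inv, rho, ← exp_transpose, transpose_neg, transpose_rhoLie]
    simp [rhoLie]
  have h2 : (rho m (-z) xᵀ)⁻¹ = (rho m z x)ᵀ := by
    rw [h1, ← transpose_nonsing_inv, nonsing_inv_nonsing_inv _ (isUnit_rho z x)]
  rw [flow, flow, h2, h1, transpose_mul, transpose_mul, mul_assoc]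

/-- Transposition reverses the action of `A`. -/
theorem transpose_act (a : A n) (x : M n) : (act a x)ᵀ = act (-a) xᵀ := by
  unfold act
  induction List.finRange (n - 1) with
  | nil => rfl
  | cons m l ih => rw [List.foldr_cons, transpose_flow, ih]; rfl

theorem transpose_mem_fiber {x : M n} (hx : x ∈ fiber n c) : xᵀ ∈ fiber n c :=
  mem_fiber_iff.mpr fun m => by
    rw [← mem_fiber_iff.mp hx m, ← charpoly_transpose (corner _ x)]
    rfl

namespace IsSpectrum

variable {μ : ∀ m : ℕ, Fin m → ℂ} (hμ : IsSpectrum c μ)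

include hμ

/-- If `xᵀ = a · x`, then `(a / 2) · x` is symmetric. -/
theorem symFiber_nonempty : (symFiber n c).Nonempty := by
  obtain ⟨x, hx⟩ := hμ.fiber_nonempty
  obtain ⟨a, ha⟩ := hμ.exists_act_eq hx (transpose_mem_fiber hx)
  refine ⟨act ((1 / 2 : ℂ) • a) x, act_mem_fiber _ hx, ?_⟩
  rw [transpose_act, ← ha, ← act_add]
  congr 1
  module

theorem symFiber_eq_orbit {x : fiber n c} (hx : x.1ᵀ = x.1) :
    symFiber n c = Subtype.val '' AddAction.orbit (F n c) x := by
  -- `a · x` is symmetric exactly when `(-a) · x = a · x`.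
  have key : ∀ a : A n, (act a x.1)ᵀ = act a x.1 ↔ (a : Ac n c) ∈ F n c := by
    intro a
    have h1 : (a : Ac n c) ∈ F n c ↔ a + a ∈ D n c := QuotientAddGroup.eq_zero_iff (a + a)
    rw [h1, hμ.mem_D_iff_act_eq x.2, transpose_act, hx, act_add]
    refine ⟨fun h => ?_, fun h => ?_⟩
    · rw [← h, ← act_add, add_neg_cancel, act_zero]
    · conv_lhs => rw [← h, ← act_add, neg_add_cancel, act_zero]
  ext y
  constructor
  · rintro ⟨hy, hyt⟩
    obtain ⟨a, rfl⟩ := hμ.exists_act_eq x.2 hy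
    exact ⟨⟨_, hy⟩, ⟨⟨a, (key a).mp hyt⟩, rfl⟩, rfl⟩
  · rintro ⟨_, ⟨⟨f, hf⟩, rfl⟩, rfl⟩
    induction f using QuotientAddGroup.induction_on with
    | H a => exact ⟨act_mem_fiber a x.2, (key a).mpr hf⟩

end IsSpectrum

end transpose

end GelfandZeitlin

open GelfandZeitlin
theorem theorem3p32 (n : ℕ) (hn : 1 ≤ n) (c : Idx n → ℂ) (hc : c ∈ Omega n) :
    -- `A_c` is a complex torus of dimension `d(n-1)`
    (∃ (L : A n ≃ₗ[ℂ] (Idx (n - 1) → ℂ)) (φ : Ac n c ≃+ Additive (Idx (n - 1) → ℂˣ)),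
      ∀ (a : A n) (i : Idx (n - 1)),
        (((φ (a : Ac n c)).toMul i : ℂˣ) : ℂ) = Complex.exp (L a i)) ∧
    -- it acts simply transitively on `M_c(n)`
    (∀ x y : fiber n c, ∃! a : Ac n c, a +ᵥ x = y) ∧
    -- the symmetric matrices in `M_c(n)`: cardinality, and a single orbit of `F_c`
    (symFiber n c).Finite ∧
    (symFiber n c).ncard = 2 ^ d (n - 1) ∧
    ∃ x : fiber n c, symFiber n c = Subtype.val '' AddAction.orbit (F n c) x := by
  obtain ⟨μ, hμ⟩ := exists_isSpectrum hc
  obtain ⟨L, φ, hφ⟩ := hμ.exists_torus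
  obtain ⟨x, hx, hxt⟩ := hμ.symFiber_nonempty
  have horbit := hμ.symFiber_eq_orbit (x := ⟨x, hx⟩) hxt
  have hrange : symFiber n c = Set.range fun f : F n c => ((f +ᵥ (⟨x, hx⟩ : fiber n c) :
      fiber n c) : M n) := horbit.trans (Set.range_comp _ _).symm
  have hinj : Function.Injective fun f : F n c => ((f +ᵥ (⟨x, hx⟩ : fiber n c) :
      fiber n c) : M n) := fun f f' h =>
    Subtype.ext ((hμ.existsUnique_vadd_eq _ _).unique (Subtype.ext h) rfl)
  have hcard : (symFiber n c).ncard = 2 ^ d (n - 1) := by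
    rw [hrange, ← Nat.card_coe_set_eq, Nat.card_range_of_injective hinj, natCard_F φ]
  exact ⟨⟨L, φ, hφ⟩, hμ.existsUnique_vadd_eq,
    Set.finite_of_ncard_pos (hcard ▸ Nat.two_pow_pos _), hcard, ⟨⟨x, hx⟩, horbit⟩⟩
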